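/- **Supercritical pitchfork for two pairs of equal masses.** Consider four bodies with masses $m_1=m_2=1$, $m_3=m_4=m$, total mass $M=2+2m$, and the unknowns $x=(\lambda_0,\mu,r_{12},r_{13},r_{14},r_{23},r_{24},r_{34})\in\mathbb R^8$. Put $$U=\sum_{i<j}\frac{m_im_j}{r_{ij}},\qquad I=\frac1M\sum_{i<j}m_im_jr_{ij}^2,\qquad V=U+\lambda_0(I-1)+\mu S,$$ where $S$ is the Cayley–Menger determinant $$S=\det\begin{pmatrix}0&1&1&1&1\\1&0&r_{12}^2&r_{13}^2&r_{14}^2\\1&r_{12}^2&0&r_{23}^2&r_{24}^2\\1&r_{13}^2&r_{23}^2&0&r_{34}^2\\1&r_{14}^2&r_{24}^2&r_{34}^2&0\end{pmatrix}.$$ Let $F(\cdot,m):\mathbb R^8\to\mathbb R^8$ be the polynomial map of the Dziobek equations, that is, the gradient of $V$ with denominators cleared: its components are $M\,\partial V/\partial\lambda_0$, $\partial V/\partial\mu$ and $M r_{ij}^2\,\partial V/\partial r_{ij}$, in the order of the unknowns. Let $DF$ be its Jacobian matrix in $x$ and $F_m$ its partial derivative in $m$. Let $R$ be the linear involution of $\mathbb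 R^8$ that exchanges $r_{13}\leftrightarrow r_{23}$ and $r_{14}\leftrightarrow r_{24}$. Below, a decimal number followed by "?" denotes the closed interval centred at that number whose radius is one unit in its last digit. (1) In the box $$\lambda_0\in 4.0585641815314330056739142?,\quad \mu\in 0.7731895057295255894879076?,\quad r_{12}\in 1.0130295438471170352477195?,$$ $$r_{13},r_{23}\in 0.57621036528654983921809171?,\quad r_{14},r_{24}\in 0.99527106304736638582196968?,$$ $$r_{34}\in 0.58204027784245088387823969?,\quad m\in 0.9922994477523853474498458?$$ there is exactly one pair $(\tilde x_*,\tilde m_*)$ with $r_{13}=r_{23}$, $r_{14}=r_{24}$, $F(\tilde x_*,\tilde m_*)=0$ and $\det DF(\tilde x_*,\tilde m_*)=0$. (2) At this point $0$ is a simple eigenvalue of $A=DF(\tilde x_*,\tilde m_*)$. There are vectors $v$ and $w$ that span the one-dimensional spaces $\ker A$ and $\ker A^T$, with $Rv=-v$, $Rw=-w$, normalized so that their $r_{24}$-components equal $1$; their $r_{13}$-components lie in $0.3503863414744728128369?$ and $1.0453646029495395551308?$ respectively. With all derivatives taken at $(\tilde x_*,\tilde m_*)$, $$w^TF_m=0,\qquad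 w^T[DF_m\,v]\in 27.1877227151147526097?\ (\text{so it is}\neq0),$$ $$w^T[D^2F(v,v)]=0,\qquad w^T[D^3F(v,v,v)]\in -2639.9736664601674948?\ (\text{so it is}<0).$$ (3) The equation $F(x,m)=0$ has a supercritical pitchfork bifurcation at $(\tilde x_*,\tilde m_*)$: there are an open neighbourhood $W$ of $\tilde x_*$, numbers $\varepsilon,\delta>0$, and smooth maps $s:(\tilde m_*-\varepsilon,\tilde m_*+\varepsilon)\to\mathbb R^8$, $X:(-\delta,\delta)\to\mathbb R^8$, $T:(-\delta,\delta)\to\mathbb R$ with $s(\tilde m_*)=X(0)=\tilde x_*$, $X'(0)\neq0$, $T(0)=\tilde m_*$, $T'(0)=0$, $T''(0)>0$, such that for $x\in W$ and $|m-\tilde m_*|<\varepsilon$ one has $F(x,m)=0$ if and only if $x=s(m)$ or $(x,m)=(X(y),T(y))$ for some $y\in(-\delta,\delta)$. Moreover $F(\cdot,m)$ has exactly one zero in $W$ for $\tilde m_*-\varepsilon<m\le\tilde m_*$ and exactly three for $\tilde m_*<m<\tilde m_*+\varepsilon$, so that three solutions merge into one as $m$ decreases to $\tilde m_*$. -/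

import Mathlib

open scoped ContDiff

noncomputable section

namespace Dziobek

/-- The unknowns `(λ₀, μ, r₁₂, r₁₃, r₁₄, r₂₃, r₂₄, r₃₄)`. -/
abbrev Vars := Fin 8 → ℝ

/-- The six mutual distances, in the order `12, 13, 14, 23, 24, 34`. -/
def mutualDist (x : Vars) (k : Fin 6) : ℝ := x k.succ.succ

/-- First index of the `k`-th pair. -/
def fstIdx : Fin 6 → Fin 4 := ![0, 0, 0, 1, 1, 2]

/-- Second index of the `k`-th pair. -/
def sndIdx : Fin 6 → Fin 4 := ![1, 2, 3, 2, 3, 3]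

/-- The product `mᵢ mⱼ` of the masses of the `k`-th pair. -/
def massProd (mass : Fin 4 → ℝ) (k : Fin 6) : ℝ := mass (fstIdx k) * mass (sndIdx k)

/-- The total mass `M`. -/
def totalMass (mass : Fin 4 → ℝ) : ℝ := ∑ i, mass i

/-- The Newtonian potential `U = ∑_{i<j} mᵢ mⱼ / rᵢⱼ`. -/
def potential (mass : Fin 4 → ℝ) (x : Vars) : ℝ := ∑ k, massProd mass k / mutualDist x k

/-- The moment of inertia `I = (1/M) ∑_{i<j} mᵢ mⱼ rᵢⱼ²`. -/
def inertia (mass : Fin 4 → ℝ) (x : Vars) : ℝ :=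
  (∑ k, massProd mass k * mutualDist x k ^ 2) / totalMass mass

/-- The Cayley–Menger determinant of the six distances. -/
def cayleyMenger (x : Vars) : ℝ :=
  Matrix.det !![0, 1,       1,       1,       1;
                1, 0,       x 2 ^ 2, x 3 ^ 2, x 4 ^ 2;
                1, x 2 ^ 2, 0,       x 5 ^ 2, x 6 ^ 2;
                1, x 3 ^ 2, x 5 ^ 2, 0,       x 7 ^ 2;
                1, x 4 ^ 2, x 6 ^ 2, x 7 ^ 2, 0]

/-- The partial derivative of a function of the eight unknowns in the `i`-th one. -/
def partialDeriv (f : Vars → ℝ) (i : Fin 8) (x : Vars) : ℝ :=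
  deriv (fun t => f (Function.update x i t)) (x i)

/-- The function `V = U + λ₀ (I - I₀) + μ S` with `I₀ = 1`, whose critical points are the strictly
planar central configurations. -/
def lagrangian (mass : Fin 4 → ℝ) (x : Vars) : ℝ :=
  potential mass x + x 0 * (inertia mass x - 1) + x 1 * cayleyMenger x

/-- The polynomial system obtained from `∂V/∂λ₀ = 0`, `∂V/∂μ = 0`, `∂V/∂rᵢⱼ = 0` by clearing
denominators: multiplication by `M`, by `1` and by `M rᵢⱼ²` respectively; see
`system_eq_partialDeriv`. -/
def system (mass : Fin 4 → ℝ) (x : Vars) : Fin 8 → ℝ :=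
  Matrix.vecCons ((∑ k, massProd mass k * mutualDist x k ^ 2) - totalMass mass)
    (Matrix.vecCons (cayleyMenger x) fun k : Fin 6 =>
      -(totalMass mass * massProd mass k) + 2 * x 0 * massProd mass k * mutualDist x k ^ 3
        + totalMass mass * x 1 * mutualDist x k ^ 2 * partialDeriv cayleyMenger k.succ.succ x)

theorem differentiable_cayleyMenger_update (i : Fin 8) (x : Vars) :
    Differentiable ℝ (fun t => cayleyMenger (Function.update x i t)) := by
  unfold cayleyMenger
  simp only [Matrix.det_apply]
  refine Differentiable.fun_sum fun σ _ => Differentiable.const_smul ?_ _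
  refine Differentiable.fun_finsetProd fun j _ => ?_
  have h : ∀ l : Fin 8, Differentiable ℝ (fun t : ℝ => Function.update x i t l) := by
    intro l
    by_cases hl : l = i
    · subst hl; simp [Function.update_self]
    · simp [Function.update_of_ne hl]
  generalize σ j = a
  fin_cases a <;> fin_cases j <;> simp <;> exact (h _).pow 2

/-- Away from collisions, `system` is the gradient of `V` with its denominators cleared. -/
theorem system_eq_partialDeriv (mass : Fin 4 → ℝ) (hM : totalMass mass ≠ 0) (x : Vars)
    (hx : ∀ k, mutualDist x k ≠ 0) :
    system mass x 0 = totalMass mass * partialDeriv (lagrangian mass) 0 x ∧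
    system mass x 1 = partialDeriv (lagrangian mass) 1 x ∧
    ∀ k : Fin 6, system mass x k.succ.succ =
      totalMass mass * mutualDist x k ^ 2 * partialDeriv (lagrangian mass) k.succ.succ x := by
  refine ⟨?_, ?_, fun k => ?_⟩
  · have h : (fun t => lagrangian mass (Function.update x 0 t)) = fun t =>
        potential mass x + t * (inertia mass x - 1) + x 1 * cayleyMenger x := by
      funext t
      simp [lagrangian, potential, inertia, cayleyMenger, mutualDist, Fin.succ_ne_zero]
    have h' : HasDerivAt (fun t => potential mass x + t * (inertia mass x - 1)
        + x 1 * cayleyMenger x) (1 * (inertia mass x - 1)) (x 0) :=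
      (((hasDerivAt_id (x 0)).mul_const _).const_add _).add_const _
    rw [partialDeriv, h, h'.deriv]
    simp only [system, inertia, Matrix.cons_val_zero]
    field_simp
  · have h : (fun t => lagrangian mass (Function.update x 1 t)) = fun t =>
        potential mass x + x 0 * (inertia mass x - 1) + t * cayleyMenger x := by
      funext t
      have h1 : ∀ k : Fin 6, (k.succ.succ : Fin 8) ≠ 1 := by decide
      simp [lagrangian, potential, inertia, cayleyMenger, mutualDist, Function.update_of_ne (h1 _)]
    have h' : HasDerivAt (fun t => potential mass x + x 0 * (inertia mass x - 1)
        + t * cayleyMenger x) (1 * cayleyMenger x) (x 1) :=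
      ((hasDerivAt_id (x 1)).mul_const _).const_add _
    rw [partialDeriv, h, h'.deriv]
    simp [system]
  · have h0 : (0 : Fin 8) ≠ k.succ.succ := (Fin.succ_ne_zero _).symm
    have h1 : (1 : Fin 8) ≠ k.succ.succ := by
      have : ∀ k : Fin 6, (1 : Fin 8) ≠ k.succ.succ := by decide
      exact this k
    have hd : ∀ (t : ℝ) (l : Fin 6),
        mutualDist (Function.update x k.succ.succ t) l
          = if l = k then t else mutualDist x l := by
      intro t l
      by_cases hl : l = k
      · subst hl; simp [mutualDist]
      · simp [mutualDist, hl, Function.update_of_ne]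
    have hU : HasDerivAt (fun t => potential mass (Function.update x k.succ.succ t))
        (-(massProd mass k) / mutualDist x k ^ 2) (x k.succ.succ) := by
      have : HasDerivAt (fun t => ∑ l, massProd mass l / (if l = k then t else mutualDist x l))
          (∑ l, if l = k then -(massProd mass k) / mutualDist x k ^ 2 else 0)
          (x k.succ.succ) := by
        refine HasDerivAt.fun_sum fun l _ => ?_
        by_cases hl : l = k
        · subst hl
          simp only [if_true]
          have := (hasDerivAt_inv (hx l)).const_mul (massProd mass l)
          simpa [div_eq_mul_inv, mutualDist] using this
        · simp only [hl, if_false]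
          exact hasDerivAt_const _ _
      simpa [potential, hd] using this
    have hI : HasDerivAt (fun t => inertia mass (Function.update x k.succ.succ t))
        (2 * massProd mass k * mutualDist x k / totalMass mass) (x k.succ.succ) := by
      have : HasDerivAt (fun t => ∑ l, massProd mass l * (if l = k then t else mutualDist x l) ^ 2)
          (∑ l, if l = k then 2 * massProd mass k * mutualDist x k else 0)
          (x k.succ.succ) := by
        refine HasDerivAt.fun_sum fun l _ => ?_
        by_cases hl : l = k
        · subst hl
          simp only [if_true]
          refine ((hasDerivAt_pow 2 (x l.succ.succ)).const_mul (massProd mass l)).congr_deriv ?_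
          simp only [mutualDist]
          push_cast
          ring
        · simp only [hl, if_false]
          exact hasDerivAt_const _ _
      simpa [inertia, hd] using this.div_const (totalMass mass)
    have hS : HasDerivAt (fun t => cayleyMenger (Function.update x k.succ.succ t))
        (partialDeriv cayleyMenger k.succ.succ x) (x k.succ.succ) :=
      (differentiable_cayleyMenger_update _ x _).hasDerivAt
    have hV := (hU.add ((hI.sub_const 1).const_mul (x 0))).add (hS.const_mul (x 1))
    have hL : (fun t => lagrangian mass (Function.update x k.succ.succ t)) = fun t =>
        potential mass (Function.update x k.succ.succ t)
          + x 0 * (inertia mass (Function.update x k.succ.succ t) - 1)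
          + x 1 * cayleyMenger (Function.update x k.succ.succ t) := by
      funext t
      simp [lagrangian, Function.update_of_ne h0, Function.update_of_ne h1]
    have hV' : partialDeriv (lagrangian mass) k.succ.succ x
        = -(massProd mass k) / mutualDist x k ^ 2
          + x 0 * (2 * massProd mass k * mutualDist x k / totalMass mass)
          + x 1 * partialDeriv cayleyMenger k.succ.succ x := by
      have hV'' := hV.deriv
      unfold partialDeriv at hV'' ⊢
      rw [hL]
      exact hV''
    rw [hV']
    have hk := hx k
    simp only [system, Matrix.cons_val_succ]
    field_simp

/-- The Dziobek equations `F(x, m) = 0` for the masses `m₁ = m₂ = 1`, `m₃ = m₄ = m`. -/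
def F (m : ℝ) (x : Vars) : Fin 8 → ℝ := system ![1, 1, m, m] x

/-- The Jacobian matrix `DF(x, m)` in the unknowns `x`. -/
def jacobian (m : ℝ) (x : Vars) : Matrix (Fin 8) (Fin 8) ℝ :=
  LinearMap.toMatrix' (fderiv ℝ (F m) x : Vars →ₗ[ℝ] Vars)

/-- The vector `F_m` of partial derivatives in the parameter `m`. -/
def paramDeriv (m : ℝ) (x : Vars) : Fin 8 → ℝ := deriv (fun m' => F m' x) m

/-- The action on the unknowns of the exchange of the bodies 1 and 2. -/
def swap12 (x : Vars) : Vars := ![x 0, x 1, x 2, x 5, x 6, x 3, x 4, x 7]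

/-- `(x, m)` solves the Dziobek equations, has `r₁₃ = r₂₃` and `r₁₄ = r₂₄`, and is singular. -/
structure IsSymmetricSingularSolution (m : ℝ) (x : Vars) : Prop where
  r13_eq_r23 : x 3 = x 5
  r14_eq_r24 : x 4 = x 6
  solution : F m x = 0
  singular : (jacobian m x).det = 0

/-- Midpoints of the intervals for the unknowns. -/
def center : Vars :=
  ![4.0585641815314330056739142, 0.7731895057295255894879076, 1.0130295438471170352477195,
    0.57621036528654983921809171, 0.99527106304736638582196968,
    0.57621036528654983921809171, 0.99527106304736638582196968,
    0.58204027784245088387823969]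

/-- Radii of these intervals: one unit in the last decimal place of the midpoint. -/
def radius : Vars :=
  ![1 / 10 ^ 25, 1 / 10 ^ 25, 1 / 10 ^ 25, 1 / 10 ^ 26, 1 / 10 ^ 26, 1 / 10 ^ 26, 1 / 10 ^ 26,
    1 / 10 ^ 26]

/-- The box of pairs `(x, m)` in which the bifurcation point is located. -/
def InBox (m : ℝ) (x : Vars) : Prop :=
  (∀ i, |x i - center i| ≤ radius i) ∧ |m - 0.9922994477523853474498458| ≤ 1 / 10 ^ 25

end Dziobek

/-- The family of equations `F μ x = 0` has a supercritical pitchfork bifurcation at `(x₀, μ₀)`.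
Near `(x₀, μ₀)` the solution set is the union of a smooth branch `x = s μ`, which passes through
the parameter value `μ₀`, and of a smooth curve `(X y, T y)`, which crosses it at `y = 0` in a
direction `(X' 0, 0)` with `X' 0 ≠ 0` and has a nondegenerate minimum of the parameter there. There
is one solution near `x₀` for `μ ≤ μ₀`, and there are three for `μ > μ₀`. -/
def IsSupercriticalPitchfork {E G : Type*} [NormedAddCommGroup E] [NormedSpace ℝ E] [Zero G]
    (F : ℝ → E → G) (μ₀ : ℝ) (x₀ : E) : Prop :=
  ∃ (U : Set E) (ε δ : ℝ) (s : ℝ → E) (X : ℝ → E) (T : ℝ → ℝ),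
    IsOpen U ∧ x₀ ∈ U ∧ 0 < ε ∧ 0 < δ ∧
    ContDiffOn ℝ ∞ s (Set.Ioo (μ₀ - ε) (μ₀ + ε)) ∧ s μ₀ = x₀ ∧
    ContDiffOn ℝ ∞ X (Set.Ioo (-δ) δ) ∧ X 0 = x₀ ∧ deriv X 0 ≠ 0 ∧
    ContDiffOn ℝ ∞ T (Set.Ioo (-δ) δ) ∧ T 0 = μ₀ ∧ deriv T 0 = 0 ∧ 0 < deriv (deriv T) 0 ∧
    (∀ μ ∈ Set.Ioo (μ₀ - ε) (μ₀ + ε), ∀ x ∈ U,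
      F μ x = 0 ↔ x = s μ ∨ ∃ y ∈ Set.Ioo (-δ) δ, x = X y ∧ μ = T y) ∧
    (∀ μ ∈ Set.Ioc (μ₀ - ε) μ₀, {x ∈ U | F μ x = 0}.ncard = 1) ∧
    (∀ μ ∈ Set.Ioo μ₀ (μ₀ + ε), {x ∈ U | F μ x = 0}.ncard = 3)

end

open scoped ContDiff Topology

/-! Exchanging bodies 1 and 2 leaves `F` equivariant, so at a symmetric configuration `DF` splits
into a 6×6 block on symmetric vectors and a 2×2 block on antisymmetric ones. The first stays
invertible; the singularity sits in the second.

The pitchfork is made regular by a blow-up. A configuration is written as a symmetric one displaced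
by `y` in the direction `(α, -1, -α, 1)` of `(r₁₃, r₁₄, r₂₃, r₂₄)`. By equivariance the symmetric
part of `F` is even in `y` and the antisymmetric part is odd. Dividing the odd part by `y` and
putting `t = y²` gives a square polynomial system `G(t, u) = 0` with `u = (λ₀, μ, r₁₂, r₁₃, r₁₄,
r₃₄, α, m)` (`blowUpExpr`, `blowUp`). For `y ≠ 0` it is equivalent to `F = 0`; at `t = 0` it says
that a symmetric solution has a kernel vector of slope `α` (`fderiv_F_antiVec_slope`). The
bifurcation point is thus a nondegenerate zero of `G(0, ·)`, located by a Newton–Kantorovich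
argument (`blowUp_exists_unique_zero`).

The pitchfork coefficients are partial derivatives of the odd parts in `m` and `y²`. The implicit
function theorem for `G` gives the asymmetric branch as a function of `y²`, on which `dm/d(y²) > 0`
(`mass_deriv_pos`); for the six symmetric equations it gives the other branch. That no zero is
missed follows from `eventually_slope_close`: asymmetric zeros near the point have slopes near `α`,
hence lie near the base point of the blow-up. `isSupercriticalPitchfork_of_branches` then counts
solutions.

All numerics are integer computations: polynomials are syntax trees, enclosed on balls in
fixed-point arithmetic and checked by the kernel. -/

/-! ### Integer polynomial expressions -/

/-- Polynomial expressions with integer coefficients in variables indexed by `ι`. -/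
inductive PolyExpr (ι : Type) : Type
  | const : ℤ → PolyExpr ι
  | var : ι → PolyExpr ι
  | add : PolyExpr ι → PolyExpr ι → PolyExpr ι
  | mul : PolyExpr ι → PolyExpr ι → PolyExpr ι

namespace PolyExpr

variable {ι κ : Type}

/-- The value of an expression at a real point. -/
noncomputable def eval (z : ι → ℝ) : PolyExpr ι → ℝ
  | const k => k
  | var i => z i
  | add e f => eval z e + eval z f
  | mul e f => eval z e * eval z f

/-- Addition that drops vanishing summands. -/
def addS : PolyExpr ι → PolyExpr ι → PolyExpr ι
  | const 0, f => f
  | e, const 0 => e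
  | e, f => add e f

/-- Multiplication that drops trivial factors. -/
def mulS : PolyExpr ι → PolyExpr ι → PolyExpr ι
  | const 0, _ => const 0
  | _, const 0 => const 0
  | const 1, f => f
  | e, const 1 => e
  | e, f => mul e f

/-- Formal derivatives and substitutions are built with these simplifying operations, so that
trivial summands and factors do not swell the trees evaluated by the kernel. -/
instance : Add (PolyExpr ι) := ⟨addS⟩
instance : Mul (PolyExpr ι) := ⟨mulS⟩
instance : Neg (PolyExpr ι) := ⟨fun e => const (-1) * e⟩
instance : Sub (PolyExpr ι) := ⟨fun e f => e + -f⟩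

@[simp] theorem eval_const (z : ι → ℝ) (k : ℤ) : (const k).eval z = k := rfl

@[simp] theorem eval_var (z : ι → ℝ) (i : ι) : (var i).eval z = z i := rfl

@[simp] theorem eval_add (z : ι → ℝ) (e f : PolyExpr ι) :
    (e + f).eval z = e.eval z + f.eval z := by
  change (addS e f).eval z = _
  unfold addS
  split <;> simp [eval]

@[simp] theorem eval_mul (z : ι → ℝ) (e f : PolyExpr ι) :
    (e * f).eval z = e.eval z * f.eval z := by
  change (mulS e f).eval z = _
  unfold mulS
  split <;> simp [eval]

@[simp] theorem eval_neg (z : ι → ℝ) (e : PolyExpr ι) : (-e).eval z = -e.eval z := by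
  change (const (-1) * e).eval z = _
  simp

@[simp] theorem eval_sub (z : ι → ℝ) (e f : PolyExpr ι) :
    (e - f).eval z = e.eval z - f.eval z := by
  change (e + -f).eval z = _
  simp [sub_eq_add_neg]

/-- The formal partial derivative. -/
def pderiv [DecidableEq ι] (i : ι) : PolyExpr ι → PolyExpr ι
  | const _ => const 0
  | var j => if i = j then const 1 else const 0
  | add e f => pderiv i e + pderiv i f
  | mul e f => pderiv i e * f + e * pderiv i f

theorem contDiff_eval [Fintype ι] (e : PolyExpr ι) {n : WithTop ℕ∞} :
    ContDiff ℝ n fun z : ι → ℝ => e.eval z := by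
  induction e with
  | const k => exact contDiff_const
  | var i => exact contDiff_apply ℝ ℝ i
  | add e f he hf => exact he.add hf
  | mul e f he hf => exact he.mul hf

/-- The differential of an expression, in terms of its formal partial derivatives. -/
noncomputable def differential [Fintype ι] [DecidableEq ι] (e : PolyExpr ι) (z : ι → ℝ) :
    (ι → ℝ) →L[ℝ] ℝ :=
  ∑ i, (e.pderiv i).eval z • ContinuousLinearMap.proj i

theorem differential_apply [Fintype ι] [DecidableEq ι] (e : PolyExpr ι) (z u : ι → ℝ) :
    e.differential z u = ∑ i, (e.pderiv i).eval z * u i := by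
  simp [differential]

theorem hasStrictFDerivAt_eval [Fintype ι] [DecidableEq ι] (e : PolyExpr ι) (z : ι → ℝ) :
    HasStrictFDerivAt (fun z : ι → ℝ => e.eval z) (e.differential z) z := by
  induction e with
  | const k =>
    refine (hasStrictFDerivAt_const (k : ℝ) z).congr_fderiv ?_
    ext u
    simp [differential_apply, pderiv]
  | var i =>
    refine HasStrictFDerivAt.congr_fderiv
      (ContinuousLinearMap.proj (R := ℝ) (φ := fun _ : ι => ℝ) i).hasStrictFDerivAt ?_
    ext u
    simp [differential_apply, pderiv, apply_ite (eval z)]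
  | add e f he hf =>
    refine (he.add hf).congr_fderiv ?_
    ext u
    simp [differential_apply, pderiv, add_mul, Finset.sum_add_distrib]
  | mul e f he hf =>
    refine (he.mul hf).congr_fderiv ?_
    ext u
    simp only [differential_apply, pderiv, eval_add, eval_mul, add_mul, Finset.sum_add_distrib,
      add_apply, smul_apply, smul_eq_mul, Finset.mul_sum]
    rw [add_comm]
    congr 1 <;> exact Finset.sum_congr rfl fun i _ => by ring

@[simp] theorem eval_pderiv_const [DecidableEq ι] (z : ι → ℝ) (i : ι) (k : ℤ) :
    (pderiv i (const k)).eval z = 0 := by simp [pderiv]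

@[simp] theorem eval_pderiv_var [DecidableEq ι] (z : ι → ℝ) (i j : ι) :
    (pderiv i (var j)).eval z = if i = j then 1 else 0 := by
  simp [pderiv, apply_ite (eval z)]

@[simp] theorem eval_pderiv_add [DecidableEq ι] (z : ι → ℝ) (i : ι) (e f : PolyExpr ι) :
    (pderiv i (e + f)).eval z = (pderiv i e).eval z + (pderiv i f).eval z := by
  change (pderiv i (addS e f)).eval z = _
  unfold addS
  split <;> simp [pderiv]

@[simp] theorem eval_pderiv_mul [DecidableEq ι] (z : ι → ℝ) (i : ι) (e f : PolyExpr ι) :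
    (pderiv i (e * f)).eval z
      = (pderiv i e).eval z * f.eval z + e.eval z * (pderiv i f).eval z := by
  change (pderiv i (mulS e f)).eval z = _
  unfold mulS
  split <;> simp [pderiv]

@[simp] theorem eval_pderiv_neg [DecidableEq ι] (z : ι → ℝ) (i : ι) (e : PolyExpr ι) :
    (pderiv i (-e)).eval z = -(pderiv i e).eval z := by
  change (pderiv i (const (-1) * e)).eval z = _
  simp

@[simp] theorem eval_pderiv_sub [DecidableEq ι] (z : ι → ℝ) (i : ι) (e f : PolyExpr ι) :
    (pderiv i (e - f)).eval z = (pderiv i e).eval z - (pderiv i f).eval z := by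
  change (pderiv i (e + -f)).eval z = _
  simp [sub_eq_add_neg]

/-- The derivative of an expression along a curve. -/
theorem hasDerivAt_eval_comp [Fintype ι] [DecidableEq ι] (e : PolyExpr ι) {c : ℝ → ι → ℝ}
    {c' : ι → ℝ} {t : ℝ} (hc : HasDerivAt c c' t) :
    HasDerivAt (fun t => e.eval (c t)) (∑ i, (e.pderiv i).eval (c t) * c' i) t := by
  rw [← differential_apply]
  exact (e.hasStrictFDerivAt_eval (c t)).hasFDerivAt.comp_hasDerivAt t hc

/-- The derivative of an expression in one variable. -/
theorem hasDerivAt_eval_update [Fintype ι] [DecidableEq ι] (e : PolyExpr ι) (z : ι → ℝ) (i : ι)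
    (t : ℝ) :
    HasDerivAt (fun t => e.eval (Function.update z i t))
      ((e.pderiv i).eval (Function.update z i t)) t := by
  simpa [Pi.single_apply] using e.hasDerivAt_eval_comp (hasDerivAt_update z i t)

/-- Substitution of `(s i).1 + y * (s i).2` for the `i`-th variable, where `y` is a square root of
`q`; the result is given by its components with respect to `1` and `y`. -/
def split (s : ι → PolyExpr κ × PolyExpr κ) (q : PolyExpr κ) :
    PolyExpr ι → PolyExpr κ × PolyExpr κ
  | const k => (const k, const 0)
  | var i => s i
  | add e f => ((split s q e).1 + (split s q f).1, (split s q e).2 + (split s q f).2)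
  | mul e f =>
    ((split s q e).1 * (split s q f).1 + q * ((split s q e).2 * (split s q f).2),
      (split s q e).1 * (split s q f).2 + (split s q e).2 * (split s q f).1)

/-- The pairs multiply as in `R[y]/(y² - q)`. Even and odd parts in `y` are thus separated
symbolically, with `y²` kept as a variable of its own. -/
theorem eval_split (s : ι → PolyExpr κ × PolyExpr κ) (q : PolyExpr κ) (z : κ → ℝ) (y : ℝ)
    (hy : q.eval z = y ^ 2) (e : PolyExpr ι) :
    e.eval (fun i => (s i).1.eval z + y * (s i).2.eval z)
      = (split s q e).1.eval z + y * (split s q e).2.eval z := by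
  induction e with
  | const k => simp [split]
  | var i => rfl
  | add e f he hf => simp only [eval, split, he, hf, eval_add]; ring
  | mul e f he hf => simp only [eval, split, he, hf, eval_add, eval_mul, hy]; ring

end PolyExpr

/-! ### Ball arithmetic -/

/-- The denominator of fixed-point numbers. -/
def fixedScale : ℤ := 10 ^ 50

/-- A ball of real numbers, given by its midpoint and its radius as multiples of
`1 / fixedScale`. -/
structure FixedBall where
  mid : ℤ
  rad : ℤ

namespace FixedBall

/-- Membership of a real number in a ball. -/
def Mem (x : ℝ) (B : FixedBall) : Prop := |x * fixedScale - B.mid| ≤ B.rad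

/-- The ball of an integer. -/
def const (k : ℤ) : FixedBall := ⟨k * fixedScale, 0⟩

/-- The sum of two balls. -/
def add (B C : FixedBall) : FixedBall := ⟨B.mid + C.mid, B.rad + C.rad⟩

/-- A ball that contains the products. -/
def mul (B C : FixedBall) : FixedBall :=
  -- The floor in the midpoint costs at most one unit, and the floor in the radius loses at most one
  -- more.
  ⟨B.mid * C.mid / fixedScale, (|B.mid| * C.rad + B.rad * |C.mid| + B.rad * C.rad) / fixedScale + 2⟩

theorem fixedScale_pos : (0 : ℝ) < fixedScale := by
  norm_num [fixedScale]

theorem mem_const (k : ℤ) : Mem k (const k) := by simp [Mem, const]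

theorem Mem.add {x y : ℝ} {B C : FixedBall} (hx : Mem x B) (hy : Mem y C) :
    Mem (x + y) (B.add C) := by
  simp only [Mem, FixedBall.add, Int.cast_add] at *
  rw [abs_le] at *
  constructor <;> linarith [hx.1, hx.2, hy.1, hy.2]

theorem intCast_ediv_mem (a : ℤ) :
    (a : ℝ) / fixedScale - 1 ≤ ((a / fixedScale : ℤ) : ℝ) ∧
      ((a / fixedScale : ℤ) : ℝ) ≤ a / fixedScale := by
  have h0 : 0 < fixedScale := by norm_num [fixedScale]
  have h1 : fixedScale * (a / fixedScale) ≤ a := Int.mul_ediv_self_le h0.ne'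
  have h2 : a < fixedScale * (a / fixedScale) + fixedScale := Int.lt_mul_ediv_self_add h0
  have h1' : (fixedScale : ℝ) * ((a / fixedScale : ℤ) : ℝ) ≤ a := by exact_mod_cast h1
  have h2' : (a : ℝ) < fixedScale * ((a / fixedScale : ℤ) : ℝ) + fixedScale := by exact_mod_cast h2
  have hp := fixedScale_pos
  constructor
  · rw [sub_le_iff_le_add, div_le_iff₀ hp]; linarith
  · rw [le_div_iff₀ hp]; linarith

theorem Mem.mul {x y : ℝ} {B C : FixedBall} (hx : Mem x B) (hy : Mem y C) :
    Mem (x * y) (B.mul C) := by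
  have hp := fixedScale_pos
  simp only [Mem, FixedBall.mul] at *
  obtain ⟨l1, u1⟩ := intCast_ediv_mem (B.mid * C.mid)
  obtain ⟨l2, -⟩ := intCast_ediv_mem (|B.mid| * C.rad + B.rad * |C.mid| + B.rad * C.rad)
  set N : ℝ := ((fixedScale : ℤ) : ℝ)
  set E : ℝ := ((|B.mid| * C.rad + B.rad * |C.mid| + B.rad * C.rad : ℤ) : ℝ) with hE
  -- With `x N = b + e` and `y N = c + f`, the error of the product is `(b f + e c + e f) / N`
  -- before the two roundings.
  have key : |x * y * N - (B.mid * C.mid : ℤ) / N| ≤ E / N := by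
    have e : x * y * N - (B.mid * C.mid : ℤ) / N
        = (B.mid * (y * N - C.mid) + (x * N - B.mid) * C.mid
            + (x * N - B.mid) * (y * N - C.mid)) / N := by
      push_cast
      field_simp
      ring
    rw [e, abs_div, abs_of_pos hp]
    gcongr
    rw [hE]
    push_cast
    refine (abs_add_le _ _).trans (add_le_add ((abs_add_le _ _).trans (add_le_add ?_ ?_)) ?_)
    · rw [abs_mul]; gcongr
    · rw [abs_mul]; gcongr
    · rw [abs_mul]
      exact mul_le_mul hx hy (abs_nonneg _) ((abs_nonneg _).trans hx)
  rw [abs_le] at key ⊢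
  push_cast at *
  constructor <;> linarith [key.1, key.2]

end FixedBall

namespace PolyExpr

variable {ι : Type}

/-- An enclosure of the values of an expression on a product of balls. -/
def enclosure (B : ι → FixedBall) : PolyExpr ι → FixedBall
  | const k => .const k
  | var i => B i
  | add e f => (enclosure B e).add (enclosure B f)
  | mul e f => (enclosure B e).mul (enclosure B f)

/-- The ball operations enclose the real ones. As the enclosure is a closed integer computation, a
bound valid on a whole ball becomes a decidable statement. -/
theorem eval_mem_enclosure {B : ι → FixedBall} {z : ι → ℝ} (hz : ∀ i, FixedBall.Mem (z i) (B i))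
    (e : PolyExpr ι) : FixedBall.Mem (e.eval z) (e.enclosure B) := by
  induction e with
  | const k => exact FixedBall.mem_const k
  | var i => exact hz i
  | add e f he hf => exact he.add hf
  | mul e f he hf => exact he.mul hf

end PolyExpr

/-! ### The Dziobek equations as polynomial expressions -/

namespace Dziobek

open PolyExpr

/-- The square of the `i`-th unknown. -/
def sqExpr (i : Fin 9) : PolyExpr (Fin 9) := var i * var i

/-- The Cayley–Menger determinant. -/
def cayleyMengerExpr : PolyExpr (Fin 9) :=
  let A := sqExpr 2
  let P := sqExpr 3
  let S := sqExpr 4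
  let Q := sqExpr 5
  let T := sqExpr 6
  let D := sqExpr 7
  const 2 * (A * D * (P + Q + S + T - A - D) + P * T * (A + D + S + Q - P - T)
    + S * Q * (A + D + P + T - S - Q) - (A * P * Q + A * S * T + D * P * S + D * Q * T))

/-- The total mass; the last variable is the mass `m`. -/
def totalMassExpr : PolyExpr (Fin 9) := const 2 + const 2 * var 8

/-- The product of the masses of the `k`-th pair. -/
def massProdExpr : Fin 6 → PolyExpr (Fin 9) :=
  ![const 1, var 8, var 8, var 8, var 8, var 8 * var 8]

/-- The equation belonging to the `k`-th mutual distance. -/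
def distExpr (k : Fin 6) : PolyExpr (Fin 9) :=
  let r : PolyExpr (Fin 9) := var k.succ.succ.castSucc
  massProdExpr k * (const 2 * var 0 * (r * r * r) - totalMassExpr)
    + totalMassExpr * var 1 * (r * r) * pderiv k.succ.succ.castSucc cayleyMengerExpr

/-- The components of `F`, as polynomials in the eight unknowns and the mass. -/
def systemExpr : Fin 8 → PolyExpr (Fin 9) :=
  ![sqExpr 2 + var 8 * (sqExpr 3 + sqExpr 4 + sqExpr 5 + sqExpr 6) + var 8 * var 8 * sqExpr 7
      - totalMassExpr,
    cayleyMengerExpr, distExpr 0, distExpr 1, distExpr 2, distExpr 3, distExpr 4, distExpr 5]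

/-- The unknowns in terms of the symmetric part `(λ₀, μ, r₁₂, r₁₃, r₁₄, r₃₄)`, the slope `α` and the
mass (variables `0` to `7`): a symmetric configuration is displaced by `y` in the direction
`(0, 0, 0, α, -1, -α, 1, 0)`. -/
def displacedExpr : Fin 9 → PolyExpr (Fin 9) × PolyExpr (Fin 9) :=
  ![(var 0, const 0), (var 1, const 0), (var 2, const 0), (var 3, var 6), (var 4, const (-1)),
    (var 3, -var 6), (var 4, const 1), (var 5, const 0), (var 7, const 0)]

/-- The even part of the displaced `i`-th equation; variable `8` is `y²`. -/
def evenExpr (i : Fin 8) : PolyExpr (Fin 9) := (split displacedExpr (var 8) (systemExpr i)).1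

/-- The odd part of the displaced `i`-th equation, divided by `y`. -/
def oddExpr (i : Fin 8) : PolyExpr (Fin 9) := (split displacedExpr (var 8) (systemExpr i)).2

/-- The blown-up equations. -/
def blowUpExpr : Fin 8 → PolyExpr (Fin 9) :=
  -- Equations 4 and 5 are omitted: they are the mirror images of 6 and 3 and have the same even
  -- parts and, up to sign, the same odd parts.
  ![evenExpr 0, evenExpr 1, evenExpr 2, evenExpr 3, evenExpr 6, evenExpr 7, oddExpr 3, oddExpr 6]

/-- The eight unknowns followed by a parameter. -/
def extend (x : Vars) (m : ℝ) : Fin 9 → ℝ := ![x 0, x 1, x 2, x 3, x 4, x 5, x 6, x 7, m]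

theorem extend_castSucc (x : Vars) (m : ℝ) (i : Fin 8) : extend x m i.castSucc = x i := by
  fin_cases i <;> rfl

theorem extend_update (x : Vars) (m : ℝ) (i : Fin 8) (t : ℝ) :
    extend (Function.update x i t) m = Function.update (extend x m) i.castSucc t := by
  funext j
  fin_cases i <;> fin_cases j <;> simp [extend]

theorem extend_eq_update (x : Vars) (m m' : ℝ) :
    extend x m' = Function.update (extend x m) 8 m' := by
  funext j
  fin_cases j <;> simp [extend]

theorem cayleyMenger_eq_eval (x : Vars) (m : ℝ) :
    cayleyMenger x = cayleyMengerExpr.eval (extend x m) := by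
  simp [cayleyMenger, cayleyMengerExpr, sqExpr, extend, Matrix.det_succ_row_zero,
    Fin.sum_univ_succ, Fin.succAbove]
  ring

theorem partialDeriv_cayleyMenger (x : Vars) (m : ℝ) (i : Fin 8) :
    partialDeriv cayleyMenger i x
      = (pderiv i.castSucc cayleyMengerExpr).eval (extend x m) := by
  have h := cayleyMengerExpr.hasDerivAt_eval_update (extend x m) i.castSucc (x i)
  simp only [← extend_update, ← cayleyMenger_eq_eval, Function.update_eq_self] at h
  exact h.deriv

/-- The bridge from the system, which contains analytic partial derivatives of a determinant, to
expressions on which all later derivatives and bounds are computed. -/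
theorem F_apply (m : ℝ) (x : Vars) (i : Fin 8) :
    F m x i = (systemExpr i).eval (extend x m) := by
  have hM : totalMass ![1, 1, m, m] = 2 + 2 * m := by
    simp [totalMass, Fin.sum_univ_four]; ring
  have hp : ∀ k, massProd ![1, 1, m, m] k = (massProdExpr k).eval (extend x m) := by
    intro k
    fin_cases k <;> simp [massProd, massProdExpr, fstIdx, sndIdx, extend]
  have hd : ∀ k : Fin 6, system ![1, 1, m, m] x k.succ.succ
      = (distExpr k).eval (extend x m) := by
    intro k
    have h8 : extend x m 8 = m := rfl
    have h0 : extend x m 0 = x 0 := rfl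
    have h1 : extend x m 1 = x 1 := rfl
    simp only [system, Matrix.cons_val_succ, distExpr, hM, hp, partialDeriv_cayleyMenger x m,
      mutualDist, totalMassExpr, eval_add, eval_mul, eval_sub, eval_const, eval_var,
      extend_castSucc, h8, h0, h1]
    push_cast
    ring
  fin_cases i
  · simp [F, system, hM, systemExpr, Fin.sum_univ_six, massProd, fstIdx, sndIdx, mutualDist,
      sqExpr, totalMassExpr, extend]
    ring
  · exact cayleyMenger_eq_eval x m
  · exact hd 0
  · exact hd 1
  · exact hd 2
  · exact hd 3
  · exact hd 4
  · exact hd 5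

/-- The equations are equivariant under the exchange of the bodies 1 and 2. -/
theorem F_swap12 (m : ℝ) (x : Vars) : F m (swap12 x) = swap12 (F m x) := by
  funext i
  -- The two cancellation lemmas are switched off, since `simp` would turn an equation of products
  -- into a disjunction out of reach of `ring`.
  fin_cases i <;>
    simp [swap12, F_apply, systemExpr, distExpr, massProdExpr, cayleyMengerExpr, sqExpr,
      totalMassExpr, extend, -mul_eq_mul_left_iff, -mul_eq_mul_right_iff] <;> ring

/-- The configuration with the coordinates `z`, displaced by `y`. -/
def displaced (z : Fin 9 → ℝ) (y : ℝ) : Vars :=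
  ![z 0, z 1, z 2, z 3 + y * z 6, z 4 - y, z 3 - y * z 6, z 4 + y, z 5]

theorem swap12_displaced (z : Fin 9 → ℝ) (y : ℝ) :
    swap12 (displaced z y) = displaced z (-y) := by
  funext i
  fin_cases i <;> simp [swap12, displaced, sub_eq_add_neg]

theorem F_displaced_apply (z : Fin 9 → ℝ) (y : ℝ) (hy : z 8 = y ^ 2) (i : Fin 8) :
    F (z 7) (displaced z y) i = (evenExpr i).eval z + y * (oddExpr i).eval z := by
  rw [F_apply, evenExpr, oddExpr, ← eval_split displacedExpr (var 8) z y hy]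
  congr 1
  funext j
  fin_cases j <;> simp [extend, displaced, displacedExpr, sub_eq_add_neg]

/-- The displaced equations in terms of the blown-up ones. -/
theorem F_displaced (z : Fin 9 → ℝ) (y : ℝ) (hy : z 8 = y ^ 2) :
    F (z 7) (displaced z y)
      = ![(evenExpr 0).eval z, (evenExpr 1).eval z, (evenExpr 2).eval z,
          (evenExpr 3).eval z + y * (oddExpr 3).eval z,
          (evenExpr 6).eval z - y * (oddExpr 6).eval z,
          (evenExpr 3).eval z - y * (oddExpr 3).eval z,
          (evenExpr 6).eval z + y * (oddExpr 6).eval z, (evenExpr 7).eval z] := by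
  have h := F_displaced_apply z y hy
  -- The value at `-y` is the swapped value at `y`. Comparing the two expansions gives the
  -- components 4 and 5 and shows that the odd part drops out of the components fixed by the swap.
  have h' := F_displaced_apply z (-y) (by rw [hy]; ring)
  rw [← swap12_displaced, F_swap12] at h'
  have h0 := h' 0
  have h1 := h' 1
  have h2 := h' 2
  have h3 := h' 3
  have h6 := h' 6
  have h7 := h' 7
  simp only [swap12, Matrix.cons_val] at h0 h1 h2 h3 h6 h7
  funext i
  fin_cases i
  · simp; linarith [h 0]
  · simp; linarith [h 1]
  · simp; linarith [h 2]
  · simp; linarith [h 3]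
  · simp; linarith
  · simp; linarith
  · simp; linarith [h 6]
  · simp; linarith [h 7]

end Dziobek

/-! ### Approximate inverses -/

/-- An approximate left inverse with respect to the maximum norm, certified by integer tables: the
matrix `J` is enclosed by `(T ± η) / b`, and its approximate inverse is `c / a`. -/
theorem norm_sub_mulVec_mulVec_le {n : ℕ} {c T : Fin n → Fin n → ℤ} {a b η : ℤ} (ha : 0 < a)
    (hb : 0 < b)
    (hcert : ∀ i, 100 * ∑ j, (|(if i = j then a * b else 0) - ∑ k, c i k * T k j|
      + ∑ k, |c i k| * η) ≤ a * b)
    {J : Matrix (Fin n) (Fin n) ℝ} (hJ : ∀ k j, |J k j * b - T k j| ≤ η) (u : Fin n → ℝ) :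
    ‖u - (Matrix.of fun i k => (c i k : ℝ) / a).mulVec (J.mulVec u)‖ ≤ 1 / 100 * ‖u‖ := by
  have ha' : (0 : ℝ) < a := by exact_mod_cast ha
  have hb' : (0 : ℝ) < b := by exact_mod_cast hb
  refine (pi_norm_le_iff_of_nonneg (by positivity)).2 fun i => ?_
  -- An entry of `1 - C J` is the defect of the integer tables plus the effect of the entrywise
  -- error `η`; the certificate bounds the row sums, hence the operator norm for the maximum norm.
  have hrow : ∀ j, |(if i = j then (1 : ℝ) else 0) - ∑ k, (c i k : ℝ) / a * J k j|
      ≤ ((|(if i = j then a * b else 0) - ∑ k, c i k * T k j| + ∑ k, |c i k| * η : ℤ) : ℝ)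
        / (a * b) := by
    intro j
    have e : (if i = j then (1 : ℝ) else 0) - ∑ k, (c i k : ℝ) / a * J k j
        = (((if i = j then (a * b : ℝ) else 0) - ∑ k, (c i k : ℝ) * T k j)
          + -∑ k, (c i k : ℝ) * (J k j * b - T k j)) / (a * b) := by
      have h1 : ∑ k, (c i k : ℝ) / a * J k j
          = (∑ k, (c i k : ℝ) * (J k j * b)) / (a * b) := by
        rw [Finset.sum_div]
        refine Finset.sum_congr rfl fun k _ => ?_
        field_simp
      have h2 : ∑ k, (c i k : ℝ) * (J k j * b - T k j)
          = ∑ k, (c i k : ℝ) * (J k j * b) - ∑ k, (c i k : ℝ) * T k j := by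
        rw [← Finset.sum_sub_distrib]
        exact Finset.sum_congr rfl fun k _ => mul_sub _ _ _
      rw [h1, h2]
      generalize ∑ k, (c i k : ℝ) * (J k j * b) = p
      generalize ∑ k, (c i k : ℝ) * T k j = q
      split_ifs
      · field_simp
        ring
      · field_simp
        ring
    rw [e, abs_div, abs_of_pos (mul_pos ha' hb')]
    gcongr
    push_cast
    refine (abs_add_le _ _).trans (add_le_add (le_of_eq ?_) ?_)
    · split_ifs <;> simp
    · rw [abs_neg]
      refine (Finset.abs_sum_le_sum_abs _ _).trans (Finset.sum_le_sum fun k _ => ?_)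
      rw [abs_mul]
      gcongr
      exact hJ k j
  have e : (u - (Matrix.of fun i k => (c i k : ℝ) / a).mulVec (J.mulVec u)) i
      = ∑ j, ((if i = j then (1 : ℝ) else 0) - ∑ k, (c i k : ℝ) / a * J k j) * u j := by
    simp only [Pi.sub_apply, Matrix.mulVec_mulVec, sub_mul, Finset.sum_sub_distrib, ite_mul,
      one_mul, zero_mul, Finset.sum_ite_eq, Finset.mem_univ, if_true]
    rfl
  rw [e]
  calc ‖∑ j, ((if i = j then (1 : ℝ) else 0) - ∑ k, (c i k : ℝ) / a * J k j) * u j‖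
      ≤ ∑ j, ((|(if i = j then a * b else 0) - ∑ k, c i k * T k j| + ∑ k, |c i k| * η : ℤ) : ℝ)
        / (a * b) * ‖u‖ := by
        refine (norm_sum_le _ _).trans (Finset.sum_le_sum fun j _ => ?_)
        rw [norm_mul]
        exact mul_le_mul (hrow j) (norm_le_pi_norm u j) (norm_nonneg _)
          ((abs_nonneg _).trans (hrow j))
    _ ≤ 1 / 100 * ‖u‖ := by
        rw [← Finset.sum_mul, ← Finset.sum_div]
        refine mul_le_mul_of_nonneg_right ?_ (norm_nonneg u)
        rw [div_le_iff₀ (mul_pos ha' hb')]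
        have := hcert i
        have : (100 : ℝ) * ((∑ j, (|(if i = j then a * b else 0) - ∑ k, c i k * T k j|
          + ∑ k, |c i k| * η) : ℤ) : ℝ) ≤ a * b := by exact_mod_cast this
        push_cast at this ⊢
        linarith

theorem norm_le_two_mul_of_approxInverse {n : ℕ} {C J : Matrix (Fin n) (Fin n) ℝ}
    (h : ∀ u, ‖u - C.mulVec (J.mulVec u)‖ ≤ 1 / 100 * ‖u‖) (u : Fin n → ℝ) :
    ‖u‖ ≤ 2 * ‖C.mulVec (J.mulVec u)‖ := by
  have h1 := h u
  have h2 := norm_sub_norm_le u (C.mulVec (J.mulVec u))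
  linarith [norm_nonneg u]

theorem mulVec_injective_of_approxInverse {n : ℕ} {C J : Matrix (Fin n) (Fin n) ℝ}
    (h : ∀ u, ‖u - C.mulVec (J.mulVec u)‖ ≤ 1 / 100 * ‖u‖) : Function.Injective J.mulVec := by
  refine (injective_iff_map_eq_zero J.mulVecLin).2 fun u hu => ?_
  have hu' : J.mulVec u = 0 := hu
  have := norm_le_two_mul_of_approxInverse h u
  rw [hu', Matrix.mulVec_zero, norm_zero, mul_zero] at this
  exact norm_le_zero_iff.1 this

/-- `J` is injective, hence onto, so `w = J u`, and the estimate forces `u = 0`. This carries a zero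
of the preconditioned system `C ∘ G` back to a zero of `G`. -/
theorem approxInverse_mulVec_eq_zero {n : ℕ} {C J : Matrix (Fin n) (Fin n) ℝ}
    (h : ∀ u, ‖u - C.mulVec (J.mulVec u)‖ ≤ 1 / 100 * ‖u‖)
    {w : Fin n → ℝ} (hw : C.mulVec w = 0) : w = 0 := by
  obtain ⟨u, rfl⟩ := (LinearMap.injective_iff_surjective (f := J.mulVecLin)).1
    (mulVec_injective_of_approxInverse h) w
  have := norm_le_two_mul_of_approxInverse h u
  rw [show C.mulVec (J.mulVec u) = 0 from hw, norm_zero, mul_zero] at this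
  rw [norm_le_zero_iff.1 this, map_zero]

theorem ContinuousLinearMap.isInvertible_of_injective {E : Type*} [NormedAddCommGroup E]
    [NormedSpace ℝ E] [FiniteDimensional ℝ E] {f : E →L[ℝ] E} (hf : Function.Injective f) :
    f.IsInvertible :=
  ⟨(LinearEquiv.ofInjectiveEndo f.toLinearMap hf).toContinuousLinearEquiv, by ext; rfl⟩

/-- A map whose derivative is close to the identity on a ball is injective there and has a zero
near the center if its value there is small. -/
theorem injOn_and_exists_zero_of_deriv_near_id {E : Type*} [NormedAddCommGroup E] [NormedSpace ℝ E]
    [CompleteSpace E] {g : E → E} {g' : E → E →L[ℝ] E} {z₀ : E} {r ρ : ℝ}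
    (hg : ∀ z ∈ Metric.closedBall z₀ ρ, HasFDerivAt g (g' z) z)
    (hg' : ∀ z ∈ Metric.closedBall z₀ ρ, ∀ u, ‖u - g' z u‖ ≤ 1 / 2 * ‖u‖)
    (hr : 2 * ‖g z₀‖ ≤ r) (hrρ : r ≤ ρ) :
    Set.InjOn g (Metric.closedBall z₀ ρ) ∧ ∃ z ∈ Metric.closedBall z₀ r, g z = 0 := by
  have hmv : ∀ x ∈ Metric.closedBall z₀ ρ, ∀ y ∈ Metric.closedBall z₀ ρ,
      ‖g x - g y - (x - y)‖ ≤ 1 / 2 * ‖x - y‖ := by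
    intro x hx y hy
    refine Convex.norm_image_sub_le_of_norm_hasFDerivWithin_le' (φ := ContinuousLinearMap.id ℝ E)
      (fun z hz => (hg z hz).hasFDerivWithinAt) (fun z hz => ?_) (convex_closedBall z₀ ρ) hy hx
    refine ContinuousLinearMap.opNorm_le_bound _ (by norm_num) fun u => ?_
    rw [← norm_neg]
    simpa using hg' z hz u
  have happrox : ApproximatesLinearOn g (ContinuousLinearEquiv.refl ℝ E : E →L[ℝ] E)
      (Metric.closedBall z₀ ρ) (1 / 2) := by
    intro x hx y hy
    simpa using hmv x hx y hy
  refine ⟨fun x hx y hy hxy => ?_, ?_⟩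
  · have h := hmv x hx y hy
    rw [hxy, sub_self, zero_sub, norm_neg] at h
    have := norm_nonneg (x - y)
    exact sub_eq_zero.1 (norm_le_zero_iff.1 (by linarith))
  · have hr0 : 0 ≤ r := (by positivity : (0 : ℝ) ≤ 2 * ‖g z₀‖).trans hr
    -- The image of the ball of radius `r` covers the ball of radius `(1 - 1/2) r` about `g z₀`,
    -- which contains `0` by `hr`.
    have hs := happrox.surjOn_closedBall_of_nonlinearRightInverse
      { toFun := id, nnnorm := 1, bound' := fun y => by simp, right_inv' := fun y => rfl }
      hr0 (Metric.closedBall_subset_closedBall hrρ)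
    obtain ⟨z, hz, hz'⟩ := hs (show (0 : E) ∈ _ by
      rw [Metric.mem_closedBall, dist_zero_left]
      norm_num
      linarith)
    exact ⟨z, hz, hz'⟩

/-! ### Linear algebra and iterated derivatives -/

/-- A kernel vector that is not orthogonal to the left kernel belongs to a simple eigenvalue. -/
theorem Matrix.rootMultiplicity_charpoly_zero_eq_one {n : Type*} [Fintype n] [DecidableEq n]
    {A : Matrix n n ℝ} {v w : n → ℝ}
    (hv : LinearMap.ker A.mulVecLin = Submodule.span ℝ {v})
    (hw : ∀ u, w ⬝ᵥ A.mulVec u = 0) (hwv : w ⬝ᵥ v ≠ 0) :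
    A.charpoly.rootMultiplicity 0 = 1 := by
  have hv0 : v ≠ 0 := by rintro rfl; simp at hwv
  rw [← Matrix.charpoly_mulVecLin, ← LinearMap.finrank_maxGenEigenspace_eq,
    ← finrank_span_singleton (K := ℝ) hv0, ← hv]
  -- The algebraic multiplicity is now the dimension of the generalized eigenspace, so it remains to
  -- exclude Jordan chains of length two.
  suffices h : Module.End.maxGenEigenspace A.mulVecLin 0 = LinearMap.ker A.mulVecLin by rw [h]
  ext x
  rw [Module.End.mem_maxGenEigenspace]
  simp only [zero_smul, sub_zero]
  constructor
  · rintro ⟨k, hk⟩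
    induction k with
    | zero => simp only [pow_zero, Module.End.one_apply] at hk; simp [hk]
    | succ k ih =>
      rcases k with - | k
      · simpa using hk
      refine ih ?_
      rw [pow_succ', Module.End.mul_apply] at hk
      -- This vector lies in `ker A` and in the range of `A`. The range is orthogonal to `w` while
      -- `v` is not, so the vector vanishes and the exponent drops.
      have hmem : (A.mulVecLin ^ (k + 1)) x ∈ Submodule.span ℝ {v} := hv ▸ hk
      obtain ⟨t, ht⟩ := Submodule.mem_span_singleton.1 hmem
      have h0 : w ⬝ᵥ (A.mulVecLin ^ (k + 1)) x = 0 := by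
        rw [pow_succ', Module.End.mul_apply]
        exact hw _
      rw [← ht, dotProduct_smul, smul_eq_mul] at h0
      rw [← ht, (mul_eq_zero.1 h0).resolve_right hwv, zero_smul]
  · intro hx
    exact ⟨1, by simpa using hx⟩

/-- Row rank equals column rank, so the left kernel is one-dimensional as well and any nonzero
vector in it spans. -/
theorem Matrix.ker_transpose_eq_span {n : Type*} [Fintype n] [DecidableEq n]
    {A : Matrix n n ℝ} {v w : n → ℝ} (hv0 : v ≠ 0) (hw0 : w ≠ 0)
    (hv : LinearMap.ker A.mulVecLin = Submodule.span ℝ {v})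
    (hw : A.transpose.mulVec w = 0) :
    LinearMap.ker A.transpose.mulVecLin = Submodule.span ℝ {w} := by
  have h1 := A.mulVecLin.finrank_range_add_finrank_ker
  have h2 := A.transpose.mulVecLin.finrank_range_add_finrank_ker
  have h3 : A.transpose.rank = A.rank := A.rank_transpose
  rw [Matrix.rank, Matrix.rank] at h3
  rw [hv, finrank_span_singleton hv0] at h1
  have hle : Submodule.span ℝ {w} ≤ LinearMap.ker A.transpose.mulVecLin := by
    rw [Submodule.span_singleton_le_iff_mem]
    exact hw
  refine (Submodule.eq_of_le_of_finrank_eq hle ?_).symm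
  rw [finrank_span_singleton hw0]
  omega

/-- On the diagonal only the line through `x` in the direction `v` matters, which reduces `D²F(v,v)`
and `D³F(v,v,v)` to calculus in one variable. -/
theorem iteratedFDeriv_apply_const {E G : Type*} [NormedAddCommGroup E] [NormedSpace ℝ E]
    [NormedAddCommGroup G] [NormedSpace ℝ G] {f : E → G} {k : ℕ} (hf : ContDiff ℝ k f) (x v : E) :
    iteratedFDeriv ℝ k f x (fun _ => v) = iteratedDeriv k (fun t : ℝ => f (x + t • v)) 0 := by
  have h := (ContinuousLinearMap.toSpanSingleton ℝ v).iteratedFDeriv_comp_right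
    (f := fun z => f (x + z)) (hf.comp (contDiff_const.add contDiff_id)) 0 (i := k) le_rfl
  rw [iteratedDeriv_eq_iteratedFDeriv]
  have e : (fun t : ℝ => f (x + t • v))
      = (fun z => f (x + z)) ∘ ContinuousLinearMap.toSpanSingleton ℝ v := by
    funext t; simp
  rw [e, h, ContinuousMultilinearMap.compContinuousLinearMap_apply, iteratedFDeriv_comp_add_left]
  simp

/-! ### The pitchfork bifurcation -/

theorem sq_lt_of_abs_lt {y δ : ℝ} (hδ : δ ≤ 1) (hy : |y| < δ) : y ^ 2 < δ := by
  rw [← sq_abs]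
  nlinarith [abs_nonneg y]

/-- The second derivative at `0` of `y ↦ τ (y ^ 2)`. -/
theorem deriv_deriv_comp_sq {τ : ℝ → ℝ} (hτ : ContDiffAt ℝ ω τ 0) :
    deriv (fun y => τ (y ^ 2)) 0 = 0 ∧
      deriv (deriv fun y => τ (y ^ 2)) 0 = 2 * deriv τ 0 := by
  have ha : AnalyticAt ℝ τ 0 := hτ.analyticAt
  have hsq : Filter.Tendsto (fun y : ℝ => y ^ 2) (𝓝 0) (𝓝 0) := by
    simpa using (continuous_pow 2).tendsto (0 : ℝ)
  have hd : ∀ᶠ y in 𝓝 (0 : ℝ),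
      HasDerivAt (fun y => τ (y ^ 2)) (deriv τ (y ^ 2) * (2 * y)) y := by
    filter_upwards [hsq.eventually ha.eventually_analyticAt] with y hy
    have h := hasDerivAt_pow 2 y
    simp only [Nat.cast_ofNat, Nat.add_one_sub_one, pow_one] at h
    exact HasDerivAt.comp (h := fun y : ℝ => y ^ 2) y hy.differentiableAt.hasDerivAt h
  refine ⟨by simpa using hd.self_of_nhds.deriv, ?_⟩
  have he : deriv (fun y => τ (y ^ 2)) =ᶠ[𝓝 0] fun y => deriv τ (y ^ 2) * (2 * y) :=
    hd.mono fun y hy => hy.deriv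
  rw [he.deriv_eq]
  have h1 : DifferentiableAt ℝ (fun y : ℝ => deriv τ (y ^ 2)) 0 := by
    have h2 : DifferentiableAt ℝ (deriv τ) ((0 : ℝ) ^ 2) := by
      simpa using ha.deriv.differentiableAt
    exact DifferentiableAt.comp (f := fun y : ℝ => y ^ 2) 0 h2 (by fun_prop)
  have h2 := h1.hasDerivAt.mul ((hasDerivAt_id (0 : ℝ)).const_mul 2)
  have h3 := h2.deriv
  simp only [id, mul_one, mul_zero, zero_add, ne_eq, OfNat.ofNat_ne_zero, not_false_eq_true,
    zero_pow] at h3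
  refine Eq.trans ?_ (h3.trans (mul_comm _ _))
  rfl

/-- A pitchfork from two transversal branches: `s`, parametrized by the parameter, and
`(X y, τ (y ^ 2))`, parametrized by the value `y` of a linear functional vanishing on `s`. -/
theorem isSupercriticalPitchfork_of_branches {E G : Type*} [NormedAddCommGroup E]
    [NormedSpace ℝ E] [Zero G] {F : ℝ → E → G} {μ₀ : ℝ} {x₀ : E} (l : E →L[ℝ] ℝ)
    {s X : ℝ → E} {τ : ℝ → ℝ}
    (hs : ContDiffAt ℝ ω s μ₀) (hs₀ : s μ₀ = x₀) (hX : ContDiffAt ℝ ω X 0) (hX₀ : X 0 = x₀)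
    (hτ : ContDiffAt ℝ ω τ 0) (hτ₀ : τ 0 = μ₀) (hτ' : 0 < deriv τ 0)
    (hls : ∀ᶠ μ in 𝓝 μ₀, l (s μ) = 0) (hlX : ∀ᶠ y in 𝓝 (0 : ℝ), l (X y) = y)
    (hF : ∀ᶠ p : ℝ × E in 𝓝 (μ₀, x₀), F p.1 p.2 = 0 ↔
      p.2 = s p.1 ∨ (p.2 = X (l p.2) ∧ p.1 = τ (l p.2 ^ 2))) :
    IsSupercriticalPitchfork F μ₀ x₀ := by
  -- Analyticity at a point persists nearby, whereas `ContDiffAt` of order `∞` need not; hence the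
  -- class `ω` in the hypotheses.
  have hω : (ω : WithTop ℕ∞) ≠ ∞ := by decide
  have ha : AnalyticAt ℝ τ 0 := hτ.analyticAt
  have hlx₀ : l x₀ = 0 := by rw [← hX₀]; exact hlX.self_of_nhds
  -- With `δ ≤ 1`, `|y| < δ` implies `y² < δ`, so that `τ` is smooth and increasing at the squares
  -- as well.
  obtain ⟨δ, hδ, hδ1, hXδ, hlδ, hτδ, hdδ⟩ : ∃ δ > 0, δ ≤ 1 ∧
      (∀ y : ℝ, |y| < δ → ContDiffAt ℝ ω X y) ∧ (∀ y : ℝ, |y| < δ → l (X y) = y) ∧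
      (∀ y : ℝ, |y| < δ → ContDiffAt ℝ ω τ y) ∧ (∀ y : ℝ, |y| < δ → 0 < deriv τ y) := by
    have hpos : ∀ᶠ y in 𝓝 (0 : ℝ), 0 < deriv τ y :=
      ha.deriv.continuousAt.eventually (lt_mem_nhds hτ')
    have hev := ((hX.eventually hω).and hlX).and ((hτ.eventually hω).and hpos)
    obtain ⟨δ, hδ, h⟩ := Metric.eventually_nhds_iff.1 hev
    have h' : ∀ y : ℝ, |y| < min δ 1 → dist y 0 < δ := fun y hy => by
      rw [Real.dist_eq, sub_zero]
      exact hy.trans_le (min_le_left _ _)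
    exact ⟨min δ 1, lt_min hδ one_pos, min_le_right _ _, fun y hy => (h (h' y hy)).1.1,
      fun y hy => (h (h' y hy)).1.2, fun y hy => (h (h' y hy)).2.1, fun y hy => (h (h' y hy)).2.2⟩
  have hmono : StrictMonoOn τ (Set.Ioo (-δ) δ) := by
    refine strictMonoOn_of_deriv_pos (convex_Ioo _ _)
      (fun y hy => (hτδ y (abs_lt.2 hy)).continuousAt.continuousWithinAt) fun y hy => ?_
    rw [interior_Ioo] at hy
    exact hdδ y (abs_lt.2 hy)
  have hmem : ∀ y : ℝ, |y| < δ → y ^ 2 ∈ Set.Ioo (-δ) δ := fun y hy =>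
    ⟨by linarith [sq_nonneg y], sq_lt_of_abs_lt hδ1 hy⟩
  have h0mem : (0 : ℝ) ∈ Set.Ioo (-δ) δ := ⟨by linarith, hδ⟩
  obtain ⟨ε₁, hε₁, U₁, hU₁, hx₁, hFU⟩ : ∃ ε₁ > 0, ∃ U₁ : Set E, IsOpen U₁ ∧ x₀ ∈ U₁ ∧
      ∀ μ : ℝ, |μ - μ₀| < ε₁ → ∀ x ∈ U₁, (F μ x = 0 ↔
        x = s μ ∨ (x = X (l x) ∧ μ = τ (l x ^ 2))) := by
    rw [nhds_prod_eq] at hF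
    obtain ⟨p, hp, q, hq, hpq⟩ := Filter.eventually_prod_iff.1 hF
    obtain ⟨ε₁, hε₁, h⟩ := Metric.eventually_nhds_iff.1 hp
    obtain ⟨U₁, hU, hU₁, hx₁⟩ := eventually_nhds_iff.1 hq
    exact ⟨ε₁, hε₁, U₁, hU₁, hx₁, fun μ hμ x hx => hpq (h (by rwa [Real.dist_eq])) (hU x hx)⟩
  let U : Set E := U₁ ∩ {x | |l x| < δ}
  have hU : IsOpen U := hU₁.inter (isOpen_lt l.continuous.abs continuous_const)
  have hx₀ : x₀ ∈ U := ⟨hx₁, by simpa [hlx₀] using hδ⟩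
  -- `η` keeps the points `X y` inside `U`. The bound `ε ≤ τ (η²) - μ₀` below then makes each
  -- parameter above `μ₀` attained at some `|y| < η`.
  obtain ⟨η, hη, hηδ, hηU⟩ : ∃ η > 0, η < δ ∧ ∀ y : ℝ, |y| < η → X y ∈ U := by
    have h : ∀ᶠ y in 𝓝 (0 : ℝ), X y ∈ U :=
      hX.continuousAt.eventually (by rw [hX₀]; exact hU.mem_nhds hx₀)
    obtain ⟨η, hη, h⟩ := Metric.eventually_nhds_iff.1 h
    refine ⟨min η (δ / 2), lt_min hη (by linarith), (min_le_right _ _).trans_lt (by linarith),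
      fun y hy => h ?_⟩
    rw [Real.dist_eq, sub_zero]
    exact hy.trans_le (min_le_left _ _)
  obtain ⟨ε₂, hε₂, hsε⟩ : ∃ ε₂ > 0, ∀ μ : ℝ, |μ - μ₀| < ε₂ →
      ContDiffAt ℝ ω s μ ∧ s μ ∈ U ∧ l (s μ) = 0 := by
    have h : ∀ᶠ μ in 𝓝 μ₀, s μ ∈ U :=
      hs.continuousAt.eventually (by rw [hs₀]; exact hU.mem_nhds hx₀)
    obtain ⟨ε₂, hε₂, h⟩ := Metric.eventually_nhds_iff.1 ((hs.eventually hω).and (h.and hls))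
    exact ⟨ε₂, hε₂, fun μ hμ => h (by rwa [Real.dist_eq])⟩
  have hη2 : η ^ 2 ∈ Set.Ioo (-δ) δ := hmem η (by rwa [abs_of_pos hη])
  have hgap : 0 < τ (η ^ 2) - μ₀ := by
    rw [← hτ₀]
    exact sub_pos.2 (hmono h0mem hη2 (by positivity))
  let ε := min (min ε₁ ε₂) (τ (η ^ 2) - μ₀)
  have hε : 0 < ε := lt_min (lt_min hε₁ hε₂) hgap
  have hεε₁ : ε ≤ ε₁ := (min_le_left _ _).trans (min_le_left _ _)
  have hεε₂ : ε ≤ ε₂ := (min_le_left _ _).trans (min_le_right _ _)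
  have hIoo : ∀ μ ∈ Set.Ioo (μ₀ - ε) (μ₀ + ε), |μ - μ₀| < ε := fun μ hμ =>
    abs_lt.2 ⟨by linarith [hμ.1], by linarith [hμ.2]⟩
  have hzero : ∀ μ ∈ Set.Ioo (μ₀ - ε) (μ₀ + ε), ∀ x ∈ U, (F μ x = 0 ↔
      x = s μ ∨ (x = X (l x) ∧ μ = τ (l x ^ 2))) := fun μ hμ x hx =>
    hFU μ ((hIoo μ hμ).trans_le hεε₁) x hx.1
  have hsq := deriv_deriv_comp_sq hτ
  refine ⟨U, ε, δ, s, X, fun y => τ (y ^ 2), hU, hx₀, hε, hδ, ?_, hs₀, ?_, hX₀, ?_, ?_, ?_,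
    hsq.1, ?_, ?_, ?_, ?_⟩
  · exact fun μ hμ => ((hsε μ ((hIoo μ hμ).trans_le hεε₂)).1.of_le le_top).contDiffWithinAt
  · exact fun y hy => ((hXδ y (abs_lt.2 hy)).of_le le_top).contDiffWithinAt
  · intro hX'
    have h1 : HasDerivAt (fun y => l (X y)) (l (deriv X 0)) 0 :=
      l.hasFDerivAt.comp_hasDerivAt 0
        (hX.differentiableAt (by decide)).hasDerivAt
    have h2 : HasDerivAt (fun y => l (X y)) 1 0 :=
      (hasDerivAt_id (0 : ℝ)).congr_of_eventuallyEq hlX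
    have := h1.unique h2
    simp [hX'] at this
  · intro y hy
    have h := hτδ (y ^ 2) (abs_lt.2 (hmem y (abs_lt.2 hy)))
    have h' := ContDiffAt.comp (f := fun y : ℝ => y ^ 2) y h (by fun_prop)
    exact (h'.of_le le_top).contDiffWithinAt
  · simpa using hτ₀
  · rw [hsq.2]
    positivity
  · intro μ hμ x hx
    rw [hzero μ hμ x hx]
    refine or_congr_right ⟨fun h => ⟨l x, abs_lt.1 hx.2, h.1, h.2⟩, ?_⟩
    rintro ⟨y, hy, rfl, h⟩
    rw [hlδ y (abs_lt.2 hy)]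
    exact ⟨rfl, h⟩
  · intro μ hμ
    have hμ' : μ ∈ Set.Ioo (μ₀ - ε) (μ₀ + ε) := ⟨hμ.1, by linarith [hμ.2]⟩
    rw [Set.ncard_eq_one]
    refine ⟨s μ, Set.ext fun x => ⟨?_, ?_⟩⟩
    · rintro ⟨hx, hFx⟩
      rcases (hzero μ hμ' x hx).1 hFx with h | ⟨h1, h2⟩
      · exact h
      -- Otherwise monotonicity gives `μ = τ (l x ^ 2) > μ₀`; on this side only the crossing point
      -- is left.
      · have hy : l x = 0 := by
          by_contra hne
          have := hmono h0mem (hmem _ hx.2) (by positivity)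
          rw [hτ₀] at this
          linarith [hμ.2]
        rw [hy] at h1 h2
        have hμ₀ : μ = μ₀ := by rw [h2, zero_pow two_ne_zero, hτ₀]
        rw [Set.mem_singleton_iff, h1, hX₀, hμ₀, hs₀]
    · rintro rfl
      have h := (hsε μ ((hIoo μ hμ').trans_le hεε₂)).2.1
      exact ⟨h, (hzero μ hμ' _ h).2 (Or.inl rfl)⟩
  · intro μ hμ
    have hμ' : μ ∈ Set.Ioo (μ₀ - ε) (μ₀ + ε) := ⟨by linarith [hμ.1], hμ.2⟩
    have hcont : ContinuousOn τ (Set.Icc 0 (η ^ 2)) := fun t ht =>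
      (hτδ t (abs_lt.2 ⟨by linarith [ht.1], ht.2.trans_lt hη2.2⟩)).continuousAt.continuousWithinAt
    have hεη : ε ≤ τ (η ^ 2) - μ₀ := min_le_right _ _
    obtain ⟨t, ht, htμ⟩ := intermediate_value_Icc (by positivity) hcont
      (show μ ∈ Set.Icc (τ 0) (τ (η ^ 2)) from
        ⟨by rw [hτ₀]; exact hμ.1.le, by linarith [hμ.2]⟩)
    have ht0 : 0 < t := by
      refine lt_of_le_of_ne ht.1 fun h => ?_
      rw [← h, hτ₀] at htμ
      exact hμ.1.ne htμ
    have htη : t < η ^ 2 := by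
      refine lt_of_le_of_ne ht.2 fun h => ?_
      rw [h] at htμ
      linarith [hμ.2]
    obtain ⟨y, hy, rfl⟩ : ∃ y : ℝ, 0 < y ∧ y ^ 2 = t :=
      ⟨√t, Real.sqrt_pos.2 ht0, Real.sq_sqrt ht0.le⟩
    have hyη : y < η := lt_of_pow_lt_pow_left₀ 2 hη.le htη
    have hy1 : |y| < η := by rwa [abs_of_pos hy]
    have hy2 : |-y| < η := by rwa [abs_neg]
    have hl1 := hlδ y (hy1.trans hηδ)
    have hl2 := hlδ (-y) (hy2.trans hηδ)
    have hsμ := hsε μ ((hIoo μ hμ').trans_le hεε₂)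
    rw [Set.ncard_eq_three]
    refine ⟨s μ, X y, X (-y), ?_, ?_, ?_, Set.ext fun x => ⟨?_, ?_⟩⟩
    · intro h
      rw [← h, hsμ.2.2] at hl1
      exact hy.ne hl1
    · intro h
      rw [← h, hsμ.2.2] at hl2
      linarith
    · intro h
      rw [h, hl2] at hl1
      linarith
    · rintro ⟨hx, hFx⟩
      rcases (hzero μ hμ' x hx).1 hFx with h | ⟨h1, h2⟩
      · exact Or.inl h
      · have h3 : l x ^ 2 = y ^ 2 :=
          hmono.injOn (hmem _ hx.2) (hmem _ (hy1.trans hηδ)) (by rw [← h2, htμ])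
        rcases sq_eq_sq_iff_eq_or_eq_neg.1 h3 with h4 | h4
        · rw [h4] at h1; exact Or.inr (Or.inl h1)
        · rw [h4] at h1; exact Or.inr (Or.inr h1)
    · rintro (rfl | rfl | rfl)
      · exact ⟨hsμ.2.1, (hzero μ hμ' _ hsμ.2.1).2 (Or.inl rfl)⟩
      · have h := hηU y hy1
        exact ⟨h, (hzero μ hμ' _ h).2 (Or.inr ⟨by rw [hl1], by rw [hl1, htμ]⟩)⟩
      · have h := hηU (-y) hy2
        exact ⟨h, (hzero μ hμ' _ h).2 (Or.inr ⟨by rw [hl2], by rw [hl2, neg_sq, htμ]⟩)⟩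

/-! ### Derivatives of the equations at symmetric configurations -/

namespace Dziobek

open PolyExpr

/-- The vector of unknowns that is invariant under the exchange of the bodies 1 and 2 and has the
given components `λ₀, μ, r₁₂, r₁₃, r₁₄, r₃₄`. -/
def symVec (p : Fin 6 → ℝ) : Vars := ![p 0, p 1, p 2, p 3, p 4, p 3, p 4, p 5]

/-- The antisymmetric vector with components `a` and `b` at `r₁₃` and `r₂₄`. -/
def antiVec (a b : ℝ) : Vars := ![0, 0, 0, a, -b, -a, b, 0]

/-- The decomposition into the eigenspaces `1` and `-1` of the involution, which makes the
derivative at symmetric configurations block diagonal. -/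
theorem eq_symVec_add_antiVec (u : Vars) :
    u = symVec ![u 0, u 1, u 2, (u 3 + u 5) / 2, (u 4 + u 6) / 2, u 7]
      + antiVec ((u 3 - u 5) / 2) ((u 6 - u 4) / 2) := by
  funext i
  fin_cases i <;> simp [symVec, antiVec] <;> ring

theorem symVec_add_antiVec_eq_zero {p : Fin 6 → ℝ} {a b : ℝ} (h : symVec p + antiVec a b = 0) :
    p = 0 ∧ a = 0 ∧ b = 0 := by
  have h0 := congrFun h 0
  have h1 := congrFun h 1
  have h2 := congrFun h 2
  have h3 := congrFun h 3
  have h4 := congrFun h 4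
  have h5 := congrFun h 5
  have h6 := congrFun h 6
  have h7 := congrFun h 7
  simp [symVec, antiVec] at h0 h1 h2 h3 h4 h5 h6 h7
  refine ⟨?_, by linarith, by linarith⟩
  funext i
  fin_cases i <;> simp <;> linarith

theorem symVec_zero : symVec 0 = 0 := by
  funext i
  fin_cases i <;> simp [symVec]

theorem smul_antiVec (t a b : ℝ) : t • antiVec a b = antiVec (t * a) (t * b) := by
  funext i
  fin_cases i <;> simp [antiVec]

theorem antiVec_add (a b a' b' : ℝ) :
    antiVec a b + antiVec a' b' = antiVec (a + a') (b + b') := by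
  funext i
  fin_cases i <;> simp [antiVec] <;> ring

theorem antiVec_dotProduct (a b : ℝ) (u : Vars) :
    antiVec a b ⬝ᵥ u = a * (u 3 - u 5) + b * (u 6 - u 4) := by
  simp [antiVec, dotProduct, Fin.sum_univ_eight]
  ring

theorem displaced_eq (z : Fin 9 → ℝ) (y : ℝ) :
    displaced z y = displaced z 0 + y • antiVec (z 6) 1 := by
  funext i
  fin_cases i <;> simp [displaced, antiVec] <;> ring

theorem displaced_update_slope (z : Fin 9 → ℝ) (a : ℝ) :
    displaced (Function.update z 6 a) 0 = displaced z 0 := by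
  simp [displaced]

theorem displaced_update_param (z : Fin 9 → ℝ) (a y : ℝ) :
    displaced (Function.update z 8 a) y = displaced z y := by
  simp [displaced]

/-- The equations are analytic in the mass and the unknowns. -/
theorem contDiff_F {n : WithTop ℕ∞} : ContDiff ℝ n fun p : ℝ × Vars => F p.1 p.2 := by
  refine contDiff_pi.2 fun i => ?_
  simp only [F_apply]
  refine (systemExpr i).contDiff_eval.comp (contDiff_pi.2 fun j => ?_)
  fin_cases j <;> simp [extend] <;> fun_prop

theorem contDiff_F_right {n : WithTop ℕ∞} (m : ℝ) : ContDiff ℝ n (F m) :=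
  ContDiff.comp (g := fun p : ℝ × Vars => F p.1 p.2) (f := fun x : Vars => (m, x)) contDiff_F
    (contDiff_const.prodMk contDiff_id)

theorem hasFDerivAt_F (m : ℝ) (x : Vars) : HasFDerivAt (F m) (fderiv ℝ (F m) x) x :=
  ((contDiff_F_right (n := 1) m).differentiable one_ne_zero x).hasFDerivAt

theorem jacobian_mulVec (m : ℝ) (x u : Vars) :
    (jacobian m x).mulVec u = fderiv ℝ (F m) x u :=
  LinearMap.toMatrix'_mulVec _ _

theorem hasDerivAt_eval_sq (e : PolyExpr (Fin 9)) (z : Fin 9 → ℝ) (y : ℝ) :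
    HasDerivAt (fun y => e.eval (Function.update z 8 (y ^ 2)))
      (2 * y * (e.pderiv 8).eval (Function.update z 8 (y ^ 2))) y := by
  have h := hasDerivAt_pow 2 y
  simp only [Nat.cast_ofNat, Nat.add_one_sub_one, pow_one] at h
  rw [mul_comm]
  exact HasDerivAt.comp (h := fun y : ℝ => y ^ 2) y (e.hasDerivAt_eval_update z 8 (y ^ 2)) h

/-- No constraint on variable 8 is needed: the displaced configuration does not depend on it, so it
can be overwritten by `y²`. This exhibits the symmetric part as even and the antisymmetric part as
odd in `y`. -/
theorem F_displaced_sq (z : Fin 9 → ℝ) (y : ℝ) :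
    F (z 7) (displaced z y)
      = symVec (fun i => (![evenExpr 0, evenExpr 1, evenExpr 2, evenExpr 3, evenExpr 6,
            evenExpr 7] i).eval (Function.update z 8 (y ^ 2)))
        + y • antiVec ((oddExpr 3).eval (Function.update z 8 (y ^ 2)))
            ((oddExpr 6).eval (Function.update z 8 (y ^ 2))) := by
  have h := F_displaced (Function.update z 8 (y ^ 2)) y (by simp)
  rw [displaced_update_param] at h
  simp only [ne_eq, Fin.reduceEq, not_false_eq_true, Function.update_of_ne] at h
  rw [h]
  funext i
  fin_cases i <;> simp [symVec, antiVec] <;> ring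

/-- The derivative of the equations in the direction of the displacement. -/
theorem fderiv_F_antiVec_slope (z : Fin 9 → ℝ) (hz : z 8 = 0) :
    fderiv ℝ (F (z 7)) (displaced z 0) (antiVec (z 6) 1)
      = antiVec ((oddExpr 3).eval z) ((oddExpr 6).eval z) := by
  have hz' : Function.update z 8 ((0 : ℝ) ^ 2) = z := by
    rw [zero_pow two_ne_zero, ← hz, Function.update_eq_self]
  have h1 : HasDerivAt (fun y => F (z 7) (displaced z y))
      (fderiv ℝ (F (z 7)) (displaced z 0) (antiVec (z 6) 1)) 0 := by
    have hc : HasDerivAt (displaced z) (antiVec (z 6) 1) 0 := by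
      have := ((hasDerivAt_id (0 : ℝ)).smul_const (antiVec (z 6) 1)).const_add (displaced z 0)
      rw [one_smul] at this
      exact this.congr_of_eventuallyEq (Filter.Eventually.of_forall (displaced_eq z))
    exact (hasFDerivAt_F _ _).comp_hasDerivAt 0 hc
  refine h1.unique ?_
  have he : ∀ e : PolyExpr (Fin 9),
      HasDerivAt (fun y => e.eval (Function.update z 8 (y ^ 2))) 0 0 := fun e => by
    simpa using hasDerivAt_eval_sq e z 0
  have ho : ∀ e : PolyExpr (Fin 9),
      HasDerivAt (fun y => y * e.eval (Function.update z 8 (y ^ 2))) (e.eval z) 0 := fun e => by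
    have h := (hasDerivAt_id (0 : ℝ)).mul (he e)
    simp only [hz', id, one_mul, zero_mul, add_zero] at h
    exact h
  simp only [F_displaced_sq]
  refine hasDerivAt_pi.2 fun i => ?_
  have hn : ∀ e : PolyExpr (Fin 9),
      HasDerivAt (fun y => -(y * e.eval (Function.update z 8 (y ^ 2)))) (-e.eval z) 0 :=
    fun e => (ho e).neg
  fin_cases i
  · simpa [symVec, antiVec] using he (evenExpr 0)
  · simpa [symVec, antiVec] using he (evenExpr 1)
  · simpa [symVec, antiVec] using he (evenExpr 2)
  · simpa [symVec, antiVec] using (he (evenExpr 3)).fun_add (ho (oddExpr 3))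
  · simpa [symVec, antiVec] using (he (evenExpr 6)).fun_add (hn (oddExpr 6))
  · simpa [symVec, antiVec] using (he (evenExpr 3)).fun_add (hn (oddExpr 3))
  · simpa [symVec, antiVec] using (he (evenExpr 6)).fun_add (ho (oddExpr 6))
  · simpa [symVec, antiVec] using he (evenExpr 7)

/-- The derivative of the equations on antisymmetric vectors. -/
theorem fderiv_F_antiVec (z : Fin 9 → ℝ) (hz : z 8 = 0) (a b : ℝ) :
    fderiv ℝ (F (z 7)) (displaced z 0) (antiVec a b)
      = antiVec ((a - b * z 6) * ((oddExpr 3).pderiv 6).eval z + b * (oddExpr 3).eval z)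
          ((a - b * z 6) * ((oddExpr 6).pderiv 6).eval z + b * (oddExpr 6).eval z) := by
  have hslope := fderiv_F_antiVec_slope z hz
  have h10 : fderiv ℝ (F (z 7)) (displaced z 0) (antiVec 1 0)
      = antiVec (((oddExpr 3).pderiv 6).eval z) (((oddExpr 6).pderiv 6).eval z) := by
    -- The symmetric configuration does not see the slope variable, so `fderiv_F_antiVec_slope`
    -- applies to every slope `t`; both sides are then differentiated in `t`.
    have hA : ∀ t, fderiv ℝ (F (z 7)) (displaced z 0) (antiVec t 1)
        = antiVec ((oddExpr 3).eval (Function.update z 6 t))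
            ((oddExpr 6).eval (Function.update z 6 t)) := fun t => by
      have h := fderiv_F_antiVec_slope (Function.update z 6 t) (by simpa using hz)
      rwa [displaced_update_slope, Function.update_self, Function.update_of_ne (by decide)] at h
    have h1 : HasDerivAt (fun t => fderiv ℝ (F (z 7)) (displaced z 0) (antiVec t 1))
        (fderiv ℝ (F (z 7)) (displaced z 0) (antiVec 1 0)) (z 6) := by
      have hc : HasDerivAt (fun t => antiVec t 1) (antiVec 1 0) (z 6) := by
        refine hasDerivAt_pi.2 fun i => ?_
        have hi := hasDerivAt_id (z 6)
        fin_cases i <;> simp [antiVec, hasDerivAt_const, hasDerivAt_id']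
        exact hi.neg
      exact (ContinuousLinearMap.hasFDerivAt _).comp_hasDerivAt (z 6) hc
    refine h1.unique ?_
    simp only [hA]
    have h3 := (oddExpr 3).hasDerivAt_eval_update z 6 (z 6)
    have h6 := (oddExpr 6).hasDerivAt_eval_update z 6 (z 6)
    rw [Function.update_eq_self] at h3 h6
    refine hasDerivAt_pi.2 fun i => ?_
    fin_cases i
    · simpa [antiVec] using hasDerivAt_const _ _
    · simpa [antiVec] using hasDerivAt_const _ _
    · simpa [antiVec] using hasDerivAt_const _ _
    · exact h3
    · exact h6.neg
    · exact h3.neg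
    · exact h6
    · simpa [antiVec] using hasDerivAt_const _ _
  have e : antiVec a b = (a - b * z 6) • antiVec 1 0 + b • antiVec (z 6) 1 := by
    rw [smul_antiVec, smul_antiVec, antiVec_add]
    congr 1 <;> ring
  rw [e, map_add, map_smul, map_smul, hslope, h10, smul_antiVec, smul_antiVec, antiVec_add]

/-- The Jacobian matrix of the blown-up equations. -/
noncomputable def blowUpJac (z : Fin 9 → ℝ) : Matrix (Fin 8) (Fin 8) ℝ :=
  Matrix.of fun i j => ((blowUpExpr i).pderiv j.castSucc).eval z

/-- The block of the Jacobian matrix that acts on symmetric vectors. -/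
noncomputable def symJac (z : Fin 9 → ℝ) : Matrix (Fin 6) (Fin 6) ℝ :=
  (blowUpJac z).submatrix (Fin.castLE (by norm_num)) (Fin.castLE (by norm_num))

/-- The derivative of the equations on symmetric vectors. -/
theorem fderiv_F_symVec (z : Fin 9 → ℝ) (hz : z 8 = 0) (p : Fin 6 → ℝ) :
    fderiv ℝ (F (z 7)) (displaced z 0) (symVec p) = symVec ((symJac z).mulVec p) := by
  -- Along this direction only the symmetric unknowns move; slope, mass and `y²` stay fixed.
  let q : Fin 9 → ℝ := ![p 0, p 1, p 2, p 3, p 4, p 5, 0, 0, 0]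
  have hline : HasDerivAt (fun t : ℝ => z + t • q) q 0 := by
    have := ((hasDerivAt_id (0 : ℝ)).smul_const q).const_add z
    rwa [one_smul] at this
  have h0 : z + (0 : ℝ) • q = z := by simp
  have hF : ∀ t : ℝ, F (z 7) (displaced (z + t • q) 0)
      = symVec fun i => (![evenExpr 0, evenExpr 1, evenExpr 2, evenExpr 3, evenExpr 6,
          evenExpr 7] i).eval (z + t • q) := fun t => by
    have h7 : (z + t • q) 7 = z 7 := by simp [q]
    have h8 : Function.update (z + t • q) 8 ((0 : ℝ) ^ 2) = z + t • q := by
      rw [Function.update_eq_self_iff]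
      simp [q, hz]
    have := F_displaced_sq (z + t • q) 0
    rwa [h7, h8, zero_smul, add_zero] at this
  have h1 : HasDerivAt (fun t : ℝ => F (z 7) (displaced (z + t • q) 0))
      (fderiv ℝ (F (z 7)) (displaced z 0) (symVec p)) 0 := by
    have hc : HasDerivAt (fun t : ℝ => displaced (z + t • q) 0) (symVec p) 0 := by
      have := ((hasDerivAt_id (0 : ℝ)).smul_const (symVec p)).const_add (displaced z 0)
      rw [one_smul] at this
      refine this.congr_of_eventuallyEq (Filter.Eventually.of_forall fun t => ?_)
      funext i
      fin_cases i <;> simp [displaced, symVec, q]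
    have h2 := hasFDerivAt_F (z 7) (displaced (z + (0 : ℝ) • q) 0)
    have h3 := HasFDerivAt.comp_hasDerivAt (f := fun t : ℝ => displaced (z + t • q) 0)
      (0 : ℝ) h2 hc
    rwa [h0] at h3
  refine h1.unique ?_
  simp only [hF]
  have he : ∀ k : Fin 6, HasDerivAt (fun t : ℝ => (![evenExpr 0, evenExpr 1, evenExpr 2, evenExpr 3,
      evenExpr 6, evenExpr 7] k).eval (z + t • q)) ((symJac z).mulVec p k) 0 := fun k => by
    have h := (![evenExpr 0, evenExpr 1, evenExpr 2, evenExpr 3, evenExpr 6, evenExpr 7]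
      k).hasDerivAt_eval_comp hline
    rw [h0] at h
    convert h using 1
    simp only [symJac, blowUpJac, Matrix.mulVec, dotProduct, Fin.sum_univ_succ, q]
    fin_cases k <;> simp [blowUpExpr]
  refine hasDerivAt_pi.2 fun i => ?_
  fin_cases i
  · exact he 0
  · exact he 1
  · exact he 2
  · exact he 3
  · exact he 4
  · exact he 3
  · exact he 4
  · exact he 5

end Dziobek

/-! ### Pairings of the derivatives with an antisymmetric vector -/

namespace Dziobek

open PolyExpr

/-- The dot product with a vector, as a continuous linear map. -/
noncomputable def dotCLM (w : Vars) : Vars →L[ℝ] ℝ :=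
  ∑ i, w i • ContinuousLinearMap.proj (R := ℝ) (φ := fun _ : Fin 8 => ℝ) i

theorem dotCLM_apply (w u : Vars) : dotCLM w u = w ⬝ᵥ u := by
  simp [dotCLM, dotProduct]

/-- An antisymmetric vector annihilates the symmetric part, so only `y` times a function of `y²`
survives. The vanishing pitchfork conditions come from this parity. -/
theorem antiVec_dotProduct_F_displaced (z : Fin 9 → ℝ) (y w : ℝ) :
    antiVec w 1 ⬝ᵥ F (z 7) (displaced z y)
      = 2 * y * (w * (oddExpr 3).eval (Function.update z 8 (y ^ 2))
          + (oddExpr 6).eval (Function.update z 8 (y ^ 2))) := by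
  rw [antiVec_dotProduct, F_displaced_sq]
  simp [symVec, antiVec]
  ring

/-- The second and the third derivative at `0` of `y ↦ 2 y h₀(y)`, if `h₀`, `h₁` and `h₂` are
functions of `y²`, each being the derivative of the preceding one in `y²`. -/
theorem iteratedDeriv_two_mul_mul {h₀ h₁ h₂ h₃ : ℝ → ℝ}
    (hh₀ : ∀ y, HasDerivAt h₀ (2 * y * h₁ y) y) (hh₁ : ∀ y, HasDerivAt h₁ (2 * y * h₂ y) y)
    (hh₂ : ∀ y, HasDerivAt h₂ (2 * y * h₃ y) y) :
    iteratedDeriv 2 (fun y => 2 * y * h₀ y) 0 = 0 ∧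
      iteratedDeriv 3 (fun y => 2 * y * h₀ y) 0 = 12 * h₁ 0 := by
  have d1 : deriv (fun y => 2 * y * h₀ y) = fun y => 2 * h₀ y + 4 * y ^ 2 * h₁ y := by
    funext y
    refine HasDerivAt.deriv ?_
    refine ((((hasDerivAt_id y).const_mul 2).mul (hh₀ y))).congr_deriv ?_
    simp only [id]
    ring
  have d2 : deriv (fun y => 2 * h₀ y + 4 * y ^ 2 * h₁ y)
      = fun y => 12 * y * h₁ y + 8 * y ^ 3 * h₂ y := by
    funext y
    refine HasDerivAt.deriv ?_
    refine (((hh₀ y).const_mul 2).add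
      (((hasDerivAt_pow 2 y).const_mul 4).mul (hh₁ y))).congr_deriv ?_
    push_cast
    ring
  have d3 : deriv (fun y => 12 * y * h₁ y + 8 * y ^ 3 * h₂ y) 0 = 12 * h₁ 0 := by
    refine HasDerivAt.deriv ?_
    refine ((((hasDerivAt_id (0 : ℝ)).const_mul 12).mul (hh₁ 0)).add
      (((hasDerivAt_pow 3 (0 : ℝ)).const_mul 8).mul (hh₂ 0))).congr_deriv ?_
    simp
  constructor
  · simp [iteratedDeriv_succ, iteratedDeriv_zero, d1, d2]
  · simp only [iteratedDeriv_succ, iteratedDeriv_zero, d1, d2, d3]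

theorem antiVec_dotProduct_iteratedFDeriv (z : Fin 9 → ℝ) (w : ℝ) (k : ℕ) :
    antiVec w 1 ⬝ᵥ iteratedFDeriv ℝ k (F (z 7)) (displaced z 0) (fun _ => antiVec (z 6) 1)
      = iteratedDeriv k (fun y => 2 * y * (w * (oddExpr 3).eval (Function.update z 8 (y ^ 2))
          + (oddExpr 6).eval (Function.update z 8 (y ^ 2)))) 0 := by
  have h := (dotCLM (antiVec w 1)).iteratedFDeriv_comp_left (i := k) (n := k)
    ((contDiff_F_right (z 7)).contDiffAt (x := displaced z 0)) le_rfl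
  have h' := congrArg (fun L => L fun _ => antiVec (z 6) 1) h
  simp only [ContinuousLinearMap.compContinuousMultilinearMap_coe, Function.comp_apply,
    dotCLM_apply] at h'
  rw [← h', iteratedFDeriv_apply_const ((dotCLM _).contDiff.comp (contDiff_F_right (z 7)))]
  congr 1
  funext y
  rw [← antiVec_dotProduct_F_displaced, displaced_eq z y, Function.comp_apply, dotCLM_apply]

/-- In `2 y h(y²)` the quadratic coefficient is `0` and the cubic one is `2 h'(0)`; times `3!` this
gives the factor `12`. -/
theorem antiVec_dotProduct_second_third (z : Fin 9 → ℝ) (hz : z 8 = 0) (w : ℝ) :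
    antiVec w 1 ⬝ᵥ iteratedFDeriv ℝ 2 (F (z 7)) (displaced z 0)
        ![antiVec (z 6) 1, antiVec (z 6) 1] = 0 ∧
    antiVec w 1 ⬝ᵥ iteratedFDeriv ℝ 3 (F (z 7)) (displaced z 0)
        ![antiVec (z 6) 1, antiVec (z 6) 1, antiVec (z 6) 1]
      = 12 * (w * ((oddExpr 3).pderiv 8).eval z + ((oddExpr 6).pderiv 8).eval z) := by
  have hz' : Function.update z 8 ((0 : ℝ) ^ 2) = z := by
    rw [zero_pow two_ne_zero, ← hz, Function.update_eq_self]
  have hd : ∀ e f : PolyExpr (Fin 9), ∀ y : ℝ, HasDerivAt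
      (fun y => w * e.eval (Function.update z 8 (y ^ 2)) + f.eval (Function.update z 8 (y ^ 2)))
      (2 * y * (w * (e.pderiv 8).eval (Function.update z 8 (y ^ 2))
        + (f.pderiv 8).eval (Function.update z 8 (y ^ 2)))) y := fun e f y =>
    (((hasDerivAt_eval_sq e z y).const_mul w).add (hasDerivAt_eval_sq f z y)).congr_deriv (by ring)
  have h := iteratedDeriv_two_mul_mul (hd (oddExpr 3) (oddExpr 6)) (hd _ _) (hd _ _)
  have e2 : ![antiVec (z 6) 1, antiVec (z 6) 1] = fun _ : Fin 2 => antiVec (z 6) 1 := by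
    funext i
    fin_cases i <;> rfl
  have e3 : ![antiVec (z 6) 1, antiVec (z 6) 1, antiVec (z 6) 1]
      = fun _ : Fin 3 => antiVec (z 6) 1 := by
    funext i
    fin_cases i <;> rfl
  rw [hz'] at h
  rw [e3, e2, antiVec_dotProduct_iteratedFDeriv, antiVec_dotProduct_iteratedFDeriv]
  exact h

theorem hasDerivAt_F_mass (m : ℝ) (x : Vars) :
    HasDerivAt (fun m' => F m' x) (fun i => ((systemExpr i).pderiv 8).eval (extend x m)) m := by
  refine hasDerivAt_pi.2 fun i => ?_
  simp only [F_apply]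
  have h := (systemExpr i).hasDerivAt_eval_update (extend x m) 8 m
  simpa only [← extend_eq_update] using h

theorem paramDeriv_eq (m : ℝ) (x : Vars) :
    paramDeriv m x = fun i => ((systemExpr i).pderiv 8).eval (extend x m) :=
  (hasDerivAt_F_mass m x).deriv

theorem differentiable_paramDeriv (m : ℝ) : Differentiable ℝ (paramDeriv m) := by
  have h : paramDeriv m = fun x i => ((systemExpr i).pderiv 8).eval (extend x m) :=
    funext (paramDeriv_eq m)
  rw [h]
  refine ContDiff.differentiable (n := 1) (contDiff_pi.2 fun i => ?_) one_ne_zero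
  refine ((systemExpr i).pderiv 8).contDiff_eval.comp (contDiff_pi.2 fun j => ?_)
  fin_cases j <;> simp [extend] <;> fun_prop

/-- The mass is an independent variable of the odd parts, so the pairing with `F` is differentiated
in it at fixed `y`. The result vanishes at `y = 0`, and its `y`-derivative there is the mixed
coefficient. -/
theorem antiVec_dotProduct_paramDeriv (z : Fin 9 → ℝ) (y w : ℝ) :
    antiVec w 1 ⬝ᵥ paramDeriv (z 7) (displaced z y)
      = 2 * y * (w * ((oddExpr 3).pderiv 7).eval (Function.update z 8 (y ^ 2))
          + ((oddExpr 6).pderiv 7).eval (Function.update z 8 (y ^ 2))) := by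
  have h1 : HasDerivAt (fun m' => antiVec w 1 ⬝ᵥ F m' (displaced z y))
      (antiVec w 1 ⬝ᵥ paramDeriv (z 7) (displaced z y)) (z 7) := by
    simp only [← dotCLM_apply, paramDeriv_eq]
    exact (dotCLM (antiVec w 1)).hasFDerivAt.comp_hasDerivAt (z 7) (hasDerivAt_F_mass _ _)
  refine h1.unique ?_
  have e : ∀ m', antiVec w 1 ⬝ᵥ F m' (displaced z y)
      = 2 * y * (w * (oddExpr 3).eval (Function.update (Function.update z 8 (y ^ 2)) 7 m')
          + (oddExpr 6).eval (Function.update (Function.update z 8 (y ^ 2)) 7 m')) := fun m' => by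
    have h := antiVec_dotProduct_F_displaced (Function.update z 7 m') y w
    have hd : displaced (Function.update z 7 m') y = displaced z y := by simp [displaced]
    rwa [hd, Function.update_self, Function.update_comm (by decide)] at h
  simp only [e]
  have hd : ∀ e : PolyExpr (Fin 9), HasDerivAt
      (fun m' => e.eval (Function.update (Function.update z 8 (y ^ 2)) 7 m'))
      ((e.pderiv 7).eval (Function.update z 8 (y ^ 2))) (z 7) := fun e => by
    have h := e.hasDerivAt_eval_update (Function.update z 8 (y ^ 2)) 7 (z 7)
    have h7 : Function.update (Function.update z 8 (y ^ 2)) 7 (z 7)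
        = Function.update z 8 (y ^ 2) := by
      rw [Function.update_comm (by decide), Function.update_eq_self]
    rwa [h7] at h
  exact (((hd _).const_mul w).add (hd _)).const_mul (2 * y)

theorem antiVec_dotProduct_fderiv_paramDeriv (z : Fin 9 → ℝ) (hz : z 8 = 0) (w : ℝ) :
    antiVec w 1 ⬝ᵥ fderiv ℝ (paramDeriv (z 7)) (displaced z 0) (antiVec (z 6) 1)
      = 2 * (w * ((oddExpr 3).pderiv 7).eval z + ((oddExpr 6).pderiv 7).eval z) := by
  have hz' : Function.update z 8 ((0 : ℝ) ^ 2) = z := by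
    rw [zero_pow two_ne_zero, ← hz, Function.update_eq_self]
  have hc : HasDerivAt (displaced z) (antiVec (z 6) 1) 0 := by
    have := ((hasDerivAt_id (0 : ℝ)).smul_const (antiVec (z 6) 1)).const_add (displaced z 0)
    rw [one_smul] at this
    exact this.congr_of_eventuallyEq (Filter.Eventually.of_forall (displaced_eq z))
  have h1 : HasDerivAt (fun y => antiVec w 1 ⬝ᵥ paramDeriv (z 7) (displaced z y))
      (antiVec w 1 ⬝ᵥ fderiv ℝ (paramDeriv (z 7)) (displaced z 0) (antiVec (z 6) 1)) 0 := by
    simp only [← dotCLM_apply]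
    exact (dotCLM (antiVec w 1)).hasFDerivAt.comp_hasDerivAt (0 : ℝ)
      ((differentiable_paramDeriv (z 7) _).hasFDerivAt.comp_hasDerivAt (0 : ℝ) hc)
  refine h1.unique ?_
  simp only [antiVec_dotProduct_paramDeriv]
  refine (((hasDerivAt_id (0 : ℝ)).const_mul 2).mul
    (((hasDerivAt_eval_sq _ z 0).const_mul w).add (hasDerivAt_eval_sq _ z 0))).congr_deriv ?_
  simp only [Pi.add_apply, hz', id]
  ring

end Dziobek

/-! ### Certified numerics -/

namespace FixedBall

/-- The numbers of the ball, multiplied by `b`, differ from `t` by at most `η`. -/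
def Within (B : FixedBall) (b t η : ℤ) : Prop :=
  |B.mid * b - t * fixedScale| + B.rad * b ≤ η * fixedScale

instance (B : FixedBall) (b t η : ℤ) : Decidable (B.Within b t η) :=
  inferInstanceAs (Decidable (_ ≤ _))

theorem Mem.abs_mul_sub_le {x : ℝ} {B : FixedBall} {b t η : ℤ} (hx : Mem x B) (hb : 0 < b)
    (h : B.Within b t η) : |x * b - t| ≤ η := by
  have hp := fixedScale_pos
  have hb' : (0 : ℝ) < b := by exact_mod_cast hb
  have h' : |(B.mid : ℝ) * b - t * fixedScale| + B.rad * b ≤ η * fixedScale := by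
    unfold Within at h
    exact_mod_cast h
  rw [Mem] at hx
  refine le_of_mul_le_mul_right ?_ hp
  calc |x * b - t| * fixedScale
      = |(x * fixedScale - B.mid) * b + (B.mid * b - t * fixedScale)| := by
        rw [← abs_of_pos hp, ← abs_mul, abs_of_pos hp]
        congr 1
        ring
    _ ≤ |x * fixedScale - B.mid| * b + |(B.mid : ℝ) * b - t * fixedScale| := by
        refine (abs_add_le _ _).trans ?_
        rw [abs_mul, abs_of_pos hb']
    _ ≤ B.rad * b + |(B.mid : ℝ) * b - t * fixedScale| := by gcongr
    _ ≤ η * fixedScale := by linarith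

end FixedBall

namespace Dziobek

open PolyExpr

/-- An approximate zero `(λ₀, μ, r₁₂, r₁₃, r₁₄, r₃₄, α, m)` of the blown-up equations at `y = 0`,
multiplied by `fixedScale`. -/
def blowUpCenter : Fin 8 → ℤ :=
  ![405856418153143300567391420969599434769545825031071,
    77318950572952558948790758753637139372768650779611,
    101302954384711703524771947907488004027134524341377,
    57621036528654983921809171052419047386697573279388,
    99527106304736638582196968167704744451622340456733,
    58204027784245088387823968920793181181150086118840,
    35038634147447281283692294006038115785503919857061,
    99229944775238534744984576123263395446564953912555]

/-- The Jacobian matrix of the blown-up equations there, multiplied by `10 ^ 6` and rounded. -/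
def jacTable : Fin 8 → Fin 8 → ℤ :=
  -- The slope column (index 6) vanishes in the six even rows, because `α` enters the even parts
  -- only with a factor `y²`.
  ![![0, 0, 2026059, 2287093, 3950428, 1146221, 0, 1317490],
    ![0, 0, -1408745, 4717897, -2612886, 2249206, 0, 0],
    ![2079200, -5760514, -5786681, 29449041, -16309591, -1265169, 0, -4235592],
    ![379678, 3120795, 4763861, 17797558, 4816032, 2816443, 0, -3205144],
    ![1956577, -5156533, -7871393, 14368452, -12900094, 14513827, 0, 32125],
    ![388306, 3036127, -417648, 5747447, 9927394, 14417065, 0, -5522466],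
    ![692633, -3635714, 20127496, -33271694, -21916089, 16063856, 12608688, 1421930],
    ![5897620, -30957310, 35211110, -87492049, -113648100, 55169938, -13180676, 12107426]]

/-- Its inverse, multiplied by `10 ^ 5` and rounded. -/
def jacInvTable : Fin 8 → Fin 8 → ℤ :=
  ![![-152784, -322398, -56893, 111111, 111636, -63254, -2803, -2682],
    ![-67916, -36408, -25835, 40134, 27031, -21742, -942, -901],
    ![12712, 2871, 3071, 1871, -6209, 1253, 721, 690],
    ![7230, 10713, 2019, -234, -1995, 197, -44, -42],
    ![12489, -8377, 1827, -4271, -1032, 3488, -239, -228],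
    ![7304, 14054, -188, -3298, -903, 4424, 267, 255],
    ![0, -427, 1044, -2846, 3759, -1980, 5852, -1989],
    ![0, -10121, -13542, 13205, 16892, -16578, -548, -524]]

/-- The inverse of its symmetric block, multiplied by `10 ^ 5` and rounded. -/
def symInvTable : Fin 6 → Fin 6 → ℤ :=
  ![![-152784, -270616, 12387, 43555, 25216, 21559],
    ![-67916, -19007, -2555, 17433, -2009, 6758],
    ![12712, -10446, -14747, 19245, 16017, -20559],
    ![7230, 11532, 3113, -1302, -3361, 1537],
    ![12489, -3966, 7730, -10027, -8395, 10714],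
    ![7304, 9122, -6787, 3136, 7329, -3654]]

/-- The derivatives of the blown-up equations in `y²`, multiplied by `10 ^ 6` and rounded. -/
def paramTable : Fin 8 → ℤ :=
  ![2228249, -7186087, 68389480, -29122771, -58379237, 13411879, -58583242, -158756958]

/-- Points at distance at most `r / fixedScale` from the approximate zero. -/
def Near (r : ℤ) (z : Fin 9 → ℝ) : Prop :=
  (∀ j : Fin 8, |z j.castSucc * fixedScale - blowUpCenter j| ≤ r) ∧ z 8 = 0

/-- The balls of radius `r / fixedScale` about the approximate zero. -/
def centerBall (r : ℤ) : Fin 9 → FixedBall :=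
  ![⟨blowUpCenter 0, r⟩, ⟨blowUpCenter 1, r⟩, ⟨blowUpCenter 2, r⟩, ⟨blowUpCenter 3, r⟩,
    ⟨blowUpCenter 4, r⟩, ⟨blowUpCenter 5, r⟩, ⟨blowUpCenter 6, r⟩, ⟨blowUpCenter 7, r⟩, ⟨0, 0⟩]

theorem Near.mem {r : ℤ} {z : Fin 9 → ℝ} (hz : Near r z) (i : Fin 9) :
    FixedBall.Mem (z i) (centerBall r i) := by
  fin_cases i
  · exact hz.1 0
  · exact hz.1 1
  · exact hz.1 2
  · exact hz.1 3
  · exact hz.1 4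
  · exact hz.1 5
  · exact hz.1 6
  · exact hz.1 7
  · simp [FixedBall.Mem, centerBall, hz.2]

theorem Near.mono {r r' : ℤ} (h : r ≤ r') {z : Fin 9 → ℝ} (hz : Near r z) : Near r' z :=
  ⟨fun j => (hz.1 j).trans (by exact_mod_cast h), hz.2⟩

theorem Near.abs_eval_mul_sub_le {r : ℤ} {z : Fin 9 → ℝ} (hz : Near r z) {e : PolyExpr (Fin 9)}
    {b t η : ℤ} (hb : 0 < b) (h : (e.enclosure (centerBall r)).Within b t η) :
    |e.eval z * b - t| ≤ η :=
  (eval_mem_enclosure hz.mem e).abs_mul_sub_le hb h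

theorem Near.abs_eval_le {r : ℤ} {z : Fin 9 → ℝ} (hz : Near r z) {e : PolyExpr (Fin 9)}
    {b η : ℤ} (hb : 0 < b) (h : (e.enclosure (centerBall r)).Within b 0 η) :
    |e.eval z| ≤ (η : ℝ) / b := by
  have hb' : (0 : ℝ) < b := by exact_mod_cast hb
  have h' := hz.abs_eval_mul_sub_le hb h
  rwa [Int.cast_zero, sub_zero, abs_mul, abs_of_pos hb', ← le_div_iff₀ hb'] at h'

/-- The radius is `10 ^ 40 / fixedScale = 10⁻¹⁰`, the region of uniqueness. The tolerance may be
coarse, since the approximate inverse only needs a defect of at most `1/100`. -/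
theorem jacTable_within : ∀ i j : Fin 8,
    (((blowUpExpr i).pderiv j.castSucc).enclosure (centerBall (10 ^ 40))).Within (10 ^ 6)
      (jacTable i j) 2 := by
  decide +kernel

theorem jacInvTable_cert : ∀ i : Fin 8, 100 * ∑ j, (|(if i = j then 10 ^ 5 * 10 ^ 6 else 0)
    - ∑ k, jacInvTable i k * jacTable k j| + ∑ k, |jacInvTable i k| * 2) ≤ 10 ^ 5 * 10 ^ 6 := by
  decide +kernel

/-- A block of the inverse is not the inverse of the block, so the symmetric block has its own
certificate. -/
theorem symInvTable_cert : ∀ i : Fin 6, 100 * ∑ j, (|(if i = j then 10 ^ 5 * 10 ^ 6 else 0)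
    - ∑ k, symInvTable i k
        * jacTable (Fin.castLE (by norm_num) k) (Fin.castLE (by norm_num) j)|
      + ∑ k, |symInvTable i k| * 2) ≤ 10 ^ 5 * 10 ^ 6 := by
  decide +kernel

/-- An approximate inverse of the Jacobian matrix of the blown-up equations. -/
noncomputable def jacInv : Matrix (Fin 8) (Fin 8) ℝ :=
  Matrix.of fun i k => (jacInvTable i k : ℝ) / (10 ^ 5 : ℤ)

theorem blowUpJac_near {z : Fin 9 → ℝ} (hz : Near (10 ^ 40) z) (i j : Fin 8) :
    |blowUpJac z i j * (10 ^ 6 : ℤ) - jacTable i j| ≤ (2 : ℤ) :=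
  hz.abs_eval_mul_sub_le (by norm_num) (jacTable_within i j)

theorem norm_sub_jacInv_mulVec_le {z : Fin 9 → ℝ} (hz : Near (10 ^ 40) z) (u : Fin 8 → ℝ) :
    ‖u - jacInv.mulVec ((blowUpJac z).mulVec u)‖ ≤ 1 / 100 * ‖u‖ :=
  norm_sub_mulVec_mulVec_le (by norm_num) (by norm_num) jacInvTable_cert (blowUpJac_near hz) u

theorem symJac_mulVec_injective {z : Fin 9 → ℝ} (hz : Near (10 ^ 40) z) :
    Function.Injective (symJac z).mulVec :=
  mulVec_injective_of_approxInverse (norm_sub_mulVec_mulVec_le (by norm_num) (by norm_num)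
    symInvTable_cert fun i j => blowUpJac_near hz _ _)

/-- The pivot of the antisymmetric block: it determines the slope of kernel vectors and is the
denominator of `leftSlope`. The table gives about `12.6`. -/
theorem twelve_le_slope {z : Fin 9 → ℝ} (hz : Near (10 ^ 40) z) :
    12 ≤ ((oddExpr 3).pderiv 6).eval z := by
  have h : |((oddExpr 3).pderiv 6).eval z * ((10 ^ 6 : ℤ) : ℝ) - ((12608688 : ℤ) : ℝ)|
      ≤ ((2 : ℤ) : ℝ) := blowUpJac_near hz 6 6
  have := (abs_le.1 h).1
  push_cast at this
  linarith

theorem blowUp_center_within : ∀ i : Fin 8,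
    ((blowUpExpr i).enclosure (centerBall 0)).Within (10 ^ 45) 0 1 := by
  decide +kernel

/-- The radius `10⁻²⁴` covers the box of the theorem, with the approximate slope inserted before the
slope of an actual kernel vector is known. -/
theorem odd_within : ((oddExpr 3).enclosure (centerBall (10 ^ 26))).Within (10 ^ 12) 0 1 := by
  decide +kernel

/-- `leftSlope` is cleared of its denominator, which is at least `12`; dividing the bound `12` by it
leaves one unit in the last digit. The next two certificates use the same device. -/
theorem leftKernel_within :
    ((const (10 ^ 22) * (oddExpr 6).pderiv 6
      + const 10453646029495395551308 * (oddExpr 3).pderiv 6).enclosure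
        (centerBall (10 ^ 10))).Within 1 0 12 := by
  decide +kernel

theorem mixed_within :
    ((const (2 * 10 ^ 19) * ((oddExpr 6).pderiv 7 * (oddExpr 3).pderiv 6
        - (oddExpr 6).pderiv 6 * (oddExpr 3).pderiv 7)
      - const 271877227151147526097 * (oddExpr 3).pderiv 6).enclosure
        (centerBall (10 ^ 10))).Within 1 0 12 := by
  decide +kernel

theorem cubic_within :
    ((const (12 * 10 ^ 16) * ((oddExpr 6).pderiv 8 * (oddExpr 3).pderiv 6
        - (oddExpr 6).pderiv 6 * (oddExpr 3).pderiv 8)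
      + const 26399736664601674948 * (oddExpr 3).pderiv 6).enclosure
        (centerBall (10 ^ 10))).Within 1 0 12 := by
  decide +kernel

theorem paramTable_within : ∀ i : Fin 8,
    (((blowUpExpr i).pderiv 8).enclosure (centerBall (10 ^ 10))).Within (10 ^ 6)
      (paramTable i) 2 := by
  decide +kernel

end Dziobek

/-! ### The bifurcation point -/

namespace Dziobek

open PolyExpr

theorem F_displaced_eq_symVec_add (z : Fin 9 → ℝ) (y : ℝ) (hy : z 8 = y ^ 2) :
    F (z 7) (displaced z y)
      = symVec (fun i => (blowUpExpr (Fin.castLE (by norm_num) i)).eval z)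
        + antiVec (y * (oddExpr 3).eval z) (y * (oddExpr 6).eval z) := by
  have h := F_displaced_sq z y
  rw [← hy, Function.update_eq_self, smul_antiVec] at h
  rw [h]
  congr 2
  funext i
  fin_cases i <;> rfl

theorem F_displaced_eq_zero {z : Fin 9 → ℝ} {y : ℝ} (hy : z 8 = y ^ 2)
    (hz : ∀ i, (blowUpExpr i).eval z = 0) : F (z 7) (displaced z y) = 0 := by
  have h3 : (oddExpr 3).eval z = 0 := hz 6
  have h6 : (oddExpr 6).eval z = 0 := hz 7
  rw [F_displaced_eq_symVec_add z y hy, h3, h6]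
  funext i
  fin_cases i <;> simp [symVec, antiVec, hz]

theorem blowUp_eq_zero_of_odd {z : Fin 9 → ℝ} {y : ℝ} (hy : z 8 = y ^ 2)
    (hF : F (z 7) (displaced z y) = 0) (h3 : (oddExpr 3).eval z = 0)
    (h6 : (oddExpr 6).eval z = 0) (i : Fin 8) : (blowUpExpr i).eval z = 0 := by
  rw [F_displaced_eq_symVec_add z y hy] at hF
  have h := (symVec_add_antiVec_eq_zero hF).1
  fin_cases i
  · exact congrFun h 0
  · exact congrFun h 1
  · exact congrFun h 2
  · exact congrFun h 3
  · exact congrFun h 4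
  · exact congrFun h 5
  · exact h3
  · exact h6

/-- The antisymmetric equations carry a factor `y`, which cancels off the symmetric set. At `y = 0`
they are void, and the odd equations must come from a kernel vector instead. -/
theorem blowUp_eq_zero {z : Fin 9 → ℝ} {y : ℝ} (hy : z 8 = y ^ 2) (hy0 : y ≠ 0)
    (hF : F (z 7) (displaced z y) = 0) (i : Fin 8) : (blowUpExpr i).eval z = 0 := by
  have hF' := hF
  rw [F_displaced_eq_symVec_add z y hy] at hF'
  have h := symVec_add_antiVec_eq_zero hF'
  exact blowUp_eq_zero_of_odd hy hF ((mul_eq_zero.1 h.2.1).resolve_left hy0)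
    ((mul_eq_zero.1 h.2.2).resolve_left hy0) i

/-- `extend` as a continuous linear map of the parameter and the unknowns. -/
noncomputable def extendCLM : ℝ × Vars →L[ℝ] Fin 9 → ℝ :=
  LinearMap.toContinuousLinearMap
    { toFun := fun p => extend p.2 p.1
      map_add' := fun p q => by funext i; fin_cases i <;> simp [extend]
      map_smul' := fun c p => by funext i; fin_cases i <;> simp [extend] }

theorem extendCLM_apply (p : ℝ × Vars) : extendCLM p = extend p.2 p.1 := rfl

theorem extend_last (u : Vars) (s : ℝ) : extend u s 8 = s := rfl

/-- The left-hand sides of the blown-up equations. -/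
noncomputable def blowUp (p : ℝ × Vars) : Vars := fun i => (blowUpExpr i).eval (extend p.2 p.1)

theorem blowUp_apply (p : ℝ × Vars) (i : Fin 8) :
    blowUp p i = (blowUpExpr i).eval (extend p.2 p.1) := rfl

theorem contDiff_blowUp {n : WithTop ℕ∞} : ContDiff ℝ n blowUp :=
  contDiff_pi.2 fun i => (blowUpExpr i).contDiff_eval.comp extendCLM.contDiff

theorem hasFDerivAt_blowUp (s : ℝ) (u : Vars) :
    HasFDerivAt (fun u => blowUp (s, u))
      (LinearMap.toContinuousLinearMap (blowUpJac (extend u s)).mulVecLin) u := by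
  refine hasFDerivAt_pi'.2 fun i => ?_
  have h1 : HasFDerivAt (fun u : Vars => extend u s)
      (extendCLM.comp (ContinuousLinearMap.inr ℝ ℝ Vars)) u :=
    (extendCLM.hasFDerivAt (x := (s, u))).comp u (hasFDerivAt_prodMk_right s u)
  have h2 := ((blowUpExpr i).hasStrictFDerivAt_eval (extend u s)).hasFDerivAt.comp u h1
  refine h2.congr_fderiv ?_
  ext v
  simp only [ContinuousLinearMap.comp_apply, differential_apply, ContinuousLinearMap.inr_apply,
    extendCLM_apply]
  rw [Fin.sum_univ_castSucc]
  simp only [extend_castSucc]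
  rw [show extend v 0 (Fin.last 8) = 0 from rfl, mul_zero, add_zero]
  rfl

theorem near_extend_iff {r : ℤ} (hr : 0 ≤ r) (u : Vars) :
    Near r (extend u 0) ↔
      u ∈ Metric.closedBall (fun j => (blowUpCenter j : ℝ) / fixedScale)
        ((r : ℝ) / fixedScale) := by
  have hp := FixedBall.fixedScale_pos
  have hr' : (0 : ℝ) ≤ r := by exact_mod_cast hr
  rw [Metric.mem_closedBall, dist_pi_le_iff (by positivity)]
  have e : ∀ j, dist (u j) ((blowUpCenter j : ℝ) / fixedScale) ≤ (r : ℝ) / fixedScale ↔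
      |extend u 0 j.castSucc * fixedScale - blowUpCenter j| ≤ r := fun j => by
    rw [extend_castSucc, le_div_iff₀ hp, Real.dist_eq]
    have : |u j - (blowUpCenter j : ℝ) / fixedScale| * fixedScale
        = |u j * fixedScale - blowUpCenter j| := by
      rw [← abs_of_pos hp, ← abs_mul, abs_of_pos hp, sub_mul, div_mul_cancel₀ _ hp.ne']
    rw [this]
  simp only [e]
  exact ⟨fun h => h.1, fun h => ⟨h, rfl⟩⟩

theorem norm_jacInv_mulVec_le {g : Fin 8 → ℝ} {η : ℝ} (hη : 0 ≤ η) (hg : ∀ k, |g k| ≤ η) :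
    ‖jacInv.mulVec g‖ ≤ 10 * η := by
  have hrow : ∀ i : Fin 8, ∑ k, |jacInvTable i k| ≤ 10 ^ 6 := by decide +kernel
  refine (pi_norm_le_iff_of_nonneg (by positivity)).2 fun i => ?_
  refine (norm_sum_le Finset.univ fun k => jacInv i k * g k).trans ?_
  calc ∑ k, ‖jacInv i k * g k‖ ≤ ∑ k, |(jacInvTable i k : ℝ)| / 10 ^ 5 * η := by
        refine Finset.sum_le_sum fun k _ => ?_
        rw [norm_mul]
        refine mul_le_mul (le_of_eq ?_) (hg k) (norm_nonneg _) (by positivity)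
        norm_num [jacInv, abs_div]
    _ = (∑ k, |(jacInvTable i k : ℝ)|) / 10 ^ 5 * η := by
        rw [Finset.sum_div, Finset.sum_mul]
    _ ≤ 10 * η := by
        gcongr
        rw [div_le_iff₀ (by norm_num)]
        have : ((∑ k, |jacInvTable i k| : ℤ) : ℝ) ≤ ((10 ^ 6 : ℤ) : ℝ) := by
          exact_mod_cast hrow i
        push_cast at this
        linarith

theorem near_center : Near 0 (extend (fun j => (blowUpCenter j : ℝ) / fixedScale) 0) :=
  (near_extend_iff le_rfl _).2 (Metric.mem_closedBall_self (by simp))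

/-- The blown-up equations at `y = 0` have a unique zero near the approximate one. -/
theorem blowUp_exists_unique_zero :
    (∀ u u', Near (10 ^ 40) (extend u 0) → Near (10 ^ 40) (extend u' 0) →
      blowUp (0, u) = 0 → blowUp (0, u') = 0 → u = u') ∧
    ∃ u, Near (10 ^ 10) (extend u 0) ∧ blowUp (0, u) = 0 := by
  have hp := FixedBall.fixedScale_pos
  let C : Vars →L[ℝ] Vars := LinearMap.toContinuousLinearMap jacInv.mulVecLin
  have hres : ∀ k, |blowUp (0, fun j => (blowUpCenter j : ℝ) / fixedScale) k| ≤ 1 / 10 ^ 45 := by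
    intro k
    exact (near_center.abs_eval_le (by norm_num) (blowUp_center_within k)).trans (by norm_num)
  have happ : ∀ u ∈ Metric.closedBall (fun j => (blowUpCenter j : ℝ) / fixedScale)
      (((10 ^ 40 : ℤ) : ℝ) / fixedScale), ∀ v, ‖v - jacInv.mulVec
        ((blowUpJac (extend u 0)).mulVec v)‖ ≤ 1 / 100 * ‖v‖ := fun u hu v =>
    norm_sub_jacInv_mulVec_le ((near_extend_iff (by norm_num) u).2 hu) v
  -- Newton–Kantorovich for `C ∘ G`: the derivative is close to the identity on the ball of radius
  -- `10⁻¹⁰`, the residual is at most `10⁻⁴⁴`, so there is a zero within `10⁻⁴⁰`.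
  obtain ⟨hinj, u, hu, hu0⟩ := injOn_and_exists_zero_of_deriv_near_id
    (g := fun u => C (blowUp (0, u)))
    (g' := fun u => C.comp (LinearMap.toContinuousLinearMap (blowUpJac (extend u 0)).mulVecLin))
    (z₀ := fun j => (blowUpCenter j : ℝ) / fixedScale)
    (r := ((10 ^ 10 : ℤ) : ℝ) / fixedScale) (ρ := ((10 ^ 40 : ℤ) : ℝ) / fixedScale)
    (fun u _ => C.hasFDerivAt.comp u (hasFDerivAt_blowUp 0 u))
    (fun u hu v => (happ u hu v).trans (by gcongr; norm_num))
    (by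
      have h : ‖C (blowUp (0, fun j => (blowUpCenter j : ℝ) / fixedScale))‖ ≤ 10 * (1 / 10 ^ 45) :=
        norm_jacInv_mulVec_le (by norm_num) hres
      refine (mul_le_mul_of_nonneg_left h (by norm_num)).trans ?_
      norm_num [fixedScale])
    (by gcongr <;> norm_num)
  refine ⟨fun u u' hu hu' h h' => ?_, u, (near_extend_iff (by norm_num) u).2 hu, ?_⟩
  · refine hinj ((near_extend_iff (by norm_num) u).1 hu)
      ((near_extend_iff (by norm_num) u').1 hu') ?_
    simp only [h, h']
  · refine approxInverse_mulVec_eq_zero (happ u ?_) hu0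
    exact Metric.closedBall_subset_closedBall (by gcongr <;> norm_num) hu

/-- The kernel of the Jacobian matrix at a symmetric configuration near the bifurcation point. -/
theorem eq_antiVec_of_fderiv_F_eq_zero {z : Fin 9 → ℝ} (hz : Near (10 ^ 40) z) {u : Vars}
    (hu : fderiv ℝ (F (z 7)) (displaced z 0) u = 0) :
    ∃ a b, u = antiVec a b ∧
      (a - b * z 6) * ((oddExpr 3).pderiv 6).eval z + b * (oddExpr 3).eval z = 0 ∧
      (a - b * z 6) * ((oddExpr 6).pderiv 6).eval z + b * (oddExpr 6).eval z = 0 := by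
  rw [eq_symVec_add_antiVec u, map_add, fderiv_F_symVec z hz.2, fderiv_F_antiVec z hz.2] at hu
  obtain ⟨h1, h2, h3⟩ := symVec_add_antiVec_eq_zero hu
  have h4 := symJac_mulVec_injective hz (h1.trans (Matrix.mulVec_zero _).symm)
  refine ⟨_, _, ?_, h2, h3⟩
  conv_lhs => rw [eq_symVec_add_antiVec u, h4, symVec_zero, zero_add]

/-- The coordinates of a symmetric configuration with the slope `a`. -/
def symCoords (m : ℝ) (x : Vars) (a : ℝ) : Vars := ![x 0, x 1, x 2, x 3, x 4, x 7, a, m]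

theorem extend_symCoords_slope (m : ℝ) (x : Vars) (a s : ℝ) :
    extend (symCoords m x a) s 6 = a := rfl

theorem extend_symCoords_mass (m : ℝ) (x : Vars) (a s : ℝ) :
    extend (symCoords m x a) s 7 = m := rfl

theorem displaced_symCoords {x : Vars} (h3 : x 3 = x 5) (h4 : x 4 = x 6) (m a : ℝ) :
    displaced (extend (symCoords m x a) 0) 0 = x := by
  funext i
  fin_cases i <;> simp [displaced, extend, symCoords, h3, h4]

/-- The midpoints of the box are roundings of the approximate zero, so `10⁻²⁴` absorbs the rounding
and the radius; the slope, absent from the box, needs a hypothesis of its own. -/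
theorem near_symCoords {m : ℝ} {x : Vars} (hbox : InBox m x) {a : ℝ} {r : ℤ} (hr : 10 ^ 26 ≤ r)
    (ha : |a * fixedScale - blowUpCenter 6| ≤ r) : Near r (extend (symCoords m x a) 0) := by
  have hS : (fixedScale : ℝ) = 10 ^ 50 := by norm_num [fixedScale]
  have hr' : (10 ^ 26 : ℝ) ≤ r := by exact_mod_cast hr
  refine ⟨fun j => ?_, rfl⟩
  rw [extend_castSucc]
  by_cases hj : j = 6
  · subst hj
    exact ha
  refine le_trans ?_ hr'
  have hb := hbox.1
  have h0 := hb 0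
  have h1 := hb 1
  have h2 := hb 2
  have h3 := hb 3
  have h4 := hb 4
  have h7 := hb 7
  have hm := hbox.2
  clear hb ha hr hr' hbox
  simp only [center, radius, Matrix.cons_val] at h0 h1 h2 h3 h4 h7
  rw [abs_le] at *
  fin_cases j <;> simp [blowUpCenter, hS, symCoords] at hj ⊢ <;> constructor <;> linarith

/-- A singular symmetric configuration near the approximate zero has a kernel vector with a slope
close to the approximate one. -/
theorem exists_slope_of_singular {m : ℝ} {x : Vars} (hbox : InBox m x)
    (hx : IsSymmetricSingularSolution m x) :
    ∃ a : ℝ, |a * fixedScale - blowUpCenter 6| ≤ (10 ^ 40 : ℤ) ∧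
      fderiv ℝ (F m) x (antiVec a 1) = 0 := by
  have hS : (fixedScale : ℝ) = 10 ^ 50 := by norm_num [fixedScale]
  -- The approximate slope serves as reference: the formula of `fderiv_F_antiVec` is exact for any
  -- value of the slope variable.
  obtain ⟨a₀, ha₀⟩ : ∃ a₀ : ℝ, a₀ * fixedScale = blowUpCenter 6 :=
    ⟨_, div_mul_cancel₀ _ FixedBall.fixedScale_pos.ne'⟩
  obtain ⟨z, hz⟩ : ∃ z, z = extend (symCoords m x a₀) 0 := ⟨_, rfl⟩
  have hz6 : z 6 = a₀ := by rw [hz, extend_symCoords_slope]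
  have hz7 : z 7 = m := by rw [hz, extend_symCoords_mass]
  have hzx : displaced z 0 = x := by rw [hz, displaced_symCoords hx.r13_eq_r23 hx.r14_eq_r24]
  have hnear : Near (10 ^ 26) z := by
    rw [hz]
    exact near_symCoords hbox le_rfl (by rw [ha₀, sub_self, abs_zero]; norm_num)
  clear hz
  have hnear' : Near (10 ^ 40) z := hnear.mono (by norm_num)
  have hb1 := twelve_le_slope hnear'
  have ho : |(oddExpr 3).eval z| ≤ 1 / 10 ^ 12 :=
    (hnear.abs_eval_le (by norm_num) odd_within).trans (by norm_num)
  obtain ⟨u, hu0, hu⟩ := Matrix.exists_mulVec_eq_zero_iff.2 hx.singular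
  rw [jacobian_mulVec] at hu
  obtain ⟨a, b, hab, h3, -⟩ := eq_antiVec_of_fderiv_F_eq_zero (u := u) hnear'
    (by rw [hz7, hzx]; exact hu)
  have hb0 : b ≠ 0 := by
    rintro rfl
    have ha : a = 0 := by
      simp only [zero_mul, sub_zero, add_zero, mul_eq_zero] at h3
      exact h3.resolve_right (by linarith)
    apply hu0
    rw [hab, ha]
    funext i
    fin_cases i <;> simp [antiVec]
  rw [hz6] at h3
  generalize ((oddExpr 3).pderiv 6).eval z = β at *
  generalize (oddExpr 3).eval z = o at *
  -- Divided by `b`, the first antisymmetric kernel equation gives the error of the slope as `-o /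
  -- β`, far below the radius `10⁻¹⁰` of uniqueness.
  have hslope : (a / b - a₀) * β = -o := by
    field_simp
    linarith
  have hdist : |a / b - a₀| ≤ 1 / 10 ^ 12 := by
    have h : |a / b - a₀| * β = |o| := by
      rw [← abs_neg o, ← hslope, abs_mul, abs_of_pos (by linarith : 0 < β)]
    nlinarith [abs_nonneg (a / b - a₀)]
  refine ⟨a / b, ?_, ?_⟩
  · rw [← ha₀, ← sub_mul, abs_mul, abs_of_pos FixedBall.fixedScale_pos, hS]
    push_cast
    linarith
  · have hv : antiVec (a / b) 1 = b⁻¹ • antiVec a b := by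
      rw [smul_antiVec, inv_mul_cancel₀ hb0, inv_mul_eq_div]
    rw [hv, map_smul, ← hab, hu, smul_zero]

/-- A symmetric singular solution in the box is a zero of the blown-up equations. -/
theorem exists_blowUp_zero_of_singular {m : ℝ} {x : Vars} (hbox : InBox m x)
    (hx : IsSymmetricSingularSolution m x) :
    ∃ a, Near (10 ^ 40) (extend (symCoords m x a) 0) ∧ blowUp (0, symCoords m x a) = 0 := by
  obtain ⟨a, ha, hker⟩ := exists_slope_of_singular hbox hx
  refine ⟨a, near_symCoords hbox (by norm_num) ha, ?_⟩
  have hw := displaced_symCoords hx.r13_eq_r23 hx.r14_eq_r24 m a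
  have h := fderiv_F_antiVec_slope (extend (symCoords m x a) 0) (extend_last _ _)
  rw [hw, extend_symCoords_slope, extend_symCoords_mass, hker] at h
  have hodd := (symVec_add_antiVec_eq_zero (p := 0)
    (by rw [symVec_zero, zero_add]; exact h.symm)).2
  funext i
  rw [blowUp_apply]
  refine blowUp_eq_zero_of_odd (y := 0) (by simp [extend_last]) ?_ hodd.1 hodd.2 i
  rw [hw, extend_symCoords_mass]
  exact hx.solution

end Dziobek

namespace Dziobek

open PolyExpr

/-! ### The spectral data -/

section Spectral

variable {z : Fin 9 → ℝ}

theorem antiVec_one_ne_zero (a : ℝ) : antiVec a 1 ≠ 0 := fun h => by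
  simpa [antiVec] using congrFun h 6

theorem swap12_antiVec (a b : ℝ) : swap12 (antiVec a b) = -antiVec a b := by
  funext i
  fin_cases i <;> simp [swap12, antiVec]

/-- Injectivity of the symmetric block leaves antisymmetric vectors; once the odd parts vanish, the
nonzero pivot forces their slope to be `z 6`. -/
theorem ker_jacobian_eq_span (hz : Near (10 ^ 40) z) (h3 : (oddExpr 3).eval z = 0)
    (h6 : (oddExpr 6).eval z = 0) :
    LinearMap.ker (jacobian (z 7) (displaced z 0)).mulVecLin
      = Submodule.span ℝ {antiVec (z 6) 1} := by
  ext u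
  rw [LinearMap.mem_ker, Matrix.mulVecLin_apply, jacobian_mulVec, Submodule.mem_span_singleton]
  constructor
  · intro hu
    obtain ⟨a, b, rfl, h, -⟩ := eq_antiVec_of_fderiv_F_eq_zero hz hu
    rw [h3, mul_zero, add_zero] at h
    have h12 := twelve_le_slope hz
    have ha := (mul_eq_zero.1 h).resolve_right (by linarith)
    refine ⟨b, ?_⟩
    rw [smul_antiVec, mul_one, ← sub_eq_zero.1 ha]
  · rintro ⟨t, rfl⟩
    rw [map_smul, fderiv_F_antiVec_slope z hz.2, h3, h6]
    funext i
    fin_cases i <;> simp [antiVec]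

/-- The slope of the left kernel vector. -/
noncomputable def leftSlope (z : Fin 9 → ℝ) : ℝ :=
  -((oddExpr 6).pderiv 6).eval z / ((oddExpr 3).pderiv 6).eval z

theorem leftSlope_mul (hz : Near (10 ^ 40) z) :
    leftSlope z * ((oddExpr 3).pderiv 6).eval z = -((oddExpr 6).pderiv 6).eval z := by
  have h12 := twelve_le_slope hz
  exact div_mul_cancel₀ _ (by linarith)

/-- When the odd parts vanish, the range of the antisymmetric block is spanned by their
`α`-derivatives `(β, γ)`, and `leftSlope = -γ / β` is orthogonal to it. -/
theorem antiVec_leftSlope_dotProduct (hz : Near (10 ^ 40) z) (h3 : (oddExpr 3).eval z = 0)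
    (h6 : (oddExpr 6).eval z = 0) (u : Vars) :
    antiVec (leftSlope z) 1 ⬝ᵥ (jacobian (z 7) (displaced z 0)).mulVec u = 0 := by
  rw [jacobian_mulVec, eq_symVec_add_antiVec u, map_add, fderiv_F_symVec z hz.2,
    fderiv_F_antiVec z hz.2, antiVec_dotProduct, h3, h6]
  have h := leftSlope_mul hz
  generalize (symJac z).mulVec _ = p
  simp only [symVec, antiVec, Pi.add_apply, Matrix.cons_val]
  linear_combination 2 * ((u 3 - u 5) / 2 - (u 6 - u 4) / 2 * z 6) * h

theorem abs_leftSlope_sub_le (hz : Near (10 ^ 10) z) :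
    |leftSlope z - 1.0453646029495395551308| ≤ 1 / 10 ^ 22 := by
  have hz' : Near (10 ^ 40) z := hz.mono (by norm_num)
  have h12 := twelve_le_slope hz'
  have hl := leftSlope_mul hz'
  have h := hz.abs_eval_le (by norm_num) leftKernel_within
  simp only [eval_add, eval_mul, eval_const] at h
  generalize ((oddExpr 3).pderiv 6).eval z = β at *
  generalize ((oddExpr 6).pderiv 6).eval z = γ at *
  rw [abs_le] at h ⊢
  push_cast at h
  obtain ⟨h1, h2⟩ := h
  constructor <;> nlinarith

theorem abs_mixed_sub_le (hz : Near (10 ^ 10) z) :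
    |2 * (leftSlope z * ((oddExpr 3).pderiv 7).eval z + ((oddExpr 6).pderiv 7).eval z)
      - 27.1877227151147526097| ≤ 1 / 10 ^ 19 := by
  have hz' : Near (10 ^ 40) z := hz.mono (by norm_num)
  have h12 := twelve_le_slope hz'
  have hl := leftSlope_mul hz'
  have h := hz.abs_eval_le (by norm_num) mixed_within
  simp only [eval_sub, eval_mul, eval_const] at h
  generalize ((oddExpr 3).pderiv 6).eval z = β at *
  generalize ((oddExpr 6).pderiv 6).eval z = γ at *
  generalize ((oddExpr 3).pderiv 7).eval z = p at *
  generalize ((oddExpr 6).pderiv 7).eval z = q at *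
  obtain rfl : γ = -(leftSlope z * β) := by linarith
  generalize leftSlope z = l at *
  have e : ((2 * 10 ^ 19 : ℤ) : ℝ) * (q * β - -(l * β) * p) - ((271877227151147526097 : ℤ) : ℝ) * β
      = (2 * (l * p + q) - 27.1877227151147526097) * 10 ^ 19 * β := by
    push_cast
    ring
  rw [e, abs_mul, abs_of_pos (by linarith : 0 < β)] at h
  have h' : |(2 * (l * p + q) - 27.1877227151147526097) * 10 ^ 19| ≤ 1 := by
    push_cast at h
    nlinarith [abs_nonneg ((2 * (l * p + q) - 27.1877227151147526097) * 10 ^ 19)]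
  rwa [abs_mul, abs_of_pos (by norm_num : (0 : ℝ) < 10 ^ 19), ← le_div_iff₀ (by norm_num)] at h'

theorem abs_cubic_sub_le (hz : Near (10 ^ 10) z) :
    |12 * (leftSlope z * ((oddExpr 3).pderiv 8).eval z + ((oddExpr 6).pderiv 8).eval z)
      - (-2639.9736664601674948)| ≤ 1 / 10 ^ 16 := by
  have hz' : Near (10 ^ 40) z := hz.mono (by norm_num)
  have h12 := twelve_le_slope hz'
  have hl := leftSlope_mul hz'
  have h := hz.abs_eval_le (by norm_num) cubic_within
  simp only [eval_sub, eval_add, eval_mul, eval_const] at h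
  generalize ((oddExpr 3).pderiv 6).eval z = β at *
  generalize ((oddExpr 6).pderiv 6).eval z = γ at *
  generalize ((oddExpr 3).pderiv 8).eval z = p at *
  generalize ((oddExpr 6).pderiv 8).eval z = q at *
  obtain rfl : γ = -(leftSlope z * β) := by linarith
  generalize leftSlope z = l at *
  have e : ((12 * 10 ^ 16 : ℤ) : ℝ) * (q * β - -(l * β) * p) + ((26399736664601674948 : ℤ) : ℝ) * β
      = (12 * (l * p + q) - (-2639.9736664601674948)) * 10 ^ 16 * β := by
    push_cast
    ring
  rw [e, abs_mul, abs_of_pos (by linarith : 0 < β)] at h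
  have h' : |(12 * (l * p + q) - (-2639.9736664601674948)) * 10 ^ 16| ≤ 1 := by
    push_cast at h
    nlinarith [abs_nonneg ((12 * (l * p + q) - (-2639.9736664601674948)) * 10 ^ 16)]
  rwa [abs_mul, abs_of_pos (by norm_num : (0 : ℝ) < 10 ^ 16), ← le_div_iff₀ (by norm_num)] at h'

theorem abs_slope_sub_le (hz : Near (10 ^ 10) z) :
    |z 6 - 0.3503863414744728128369| ≤ 1 / 10 ^ 22 := by
  have hS : (fixedScale : ℝ) = 10 ^ 50 := by norm_num [fixedScale]
  have h : |z 6 * fixedScale - blowUpCenter 6| ≤ ((10 ^ 10 : ℤ) : ℝ) := hz.1 6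
  simp only [blowUpCenter, hS, Matrix.cons_val] at h
  rw [abs_le] at *
  push_cast at h
  constructor <;> linarith [h.1, h.2]

theorem inBox_of_near (hz : Near (10 ^ 10) z) : InBox (z 7) (displaced z 0) := by
  have hS : (fixedScale : ℝ) = 10 ^ 50 := by norm_num [fixedScale]
  have h0 : |z 0 * fixedScale - blowUpCenter 0| ≤ ((10 ^ 10 : ℤ) : ℝ) := hz.1 0
  have h1 : |z 1 * fixedScale - blowUpCenter 1| ≤ ((10 ^ 10 : ℤ) : ℝ) := hz.1 1
  have h2 : |z 2 * fixedScale - blowUpCenter 2| ≤ ((10 ^ 10 : ℤ) : ℝ) := hz.1 2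
  have h3 : |z 3 * fixedScale - blowUpCenter 3| ≤ ((10 ^ 10 : ℤ) : ℝ) := hz.1 3
  have h4 : |z 4 * fixedScale - blowUpCenter 4| ≤ ((10 ^ 10 : ℤ) : ℝ) := hz.1 4
  have h5 : |z 5 * fixedScale - blowUpCenter 5| ≤ ((10 ^ 10 : ℤ) : ℝ) := hz.1 5
  have h7 : |z 7 * fixedScale - blowUpCenter 7| ≤ ((10 ^ 10 : ℤ) : ℝ) := hz.1 7
  simp only [blowUpCenter, hS, Matrix.cons_val] at h0 h1 h2 h3 h4 h5 h7
  push_cast at h0 h1 h2 h3 h4 h5 h7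
  rw [abs_le] at h0 h1 h2 h3 h4 h5 h7
  refine ⟨fun i => ?_, ?_⟩
  · rw [abs_le]
    fin_cases i <;> simp [displaced, center, radius] <;> constructor <;> linarith
  · rw [abs_le]
    constructor <;> linarith

theorem isSymmetricSingularSolution (hz : Near (10 ^ 40) z)
    (hG : ∀ i, (blowUpExpr i).eval z = 0) :
    IsSymmetricSingularSolution (z 7) (displaced z 0) where
  r13_eq_r23 := by simp [displaced]
  r14_eq_r24 := by simp [displaced]
  solution := F_displaced_eq_zero (by rw [hz.2]; simp) hG
  singular := by
    refine Matrix.exists_mulVec_eq_zero_iff.1 ⟨antiVec (z 6) 1, antiVec_one_ne_zero _, ?_⟩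
    have h : antiVec (z 6) 1 ∈ LinearMap.ker (jacobian (z 7) (displaced z 0)).mulVecLin := by
      rw [ker_jacobian_eq_span hz (hG 6) (hG 7)]
      exact Submodule.mem_span_singleton_self _
    exact h

end Spectral

end Dziobek

/-! ### The branches -/

/-- The implicit function theorem for a curve of solutions. -/
theorem exists_implicit_branch {E : Type*} [NormedAddCommGroup E] [NormedSpace ℝ E]
    [FiniteDimensional ℝ E] {f : ℝ × E → E} (hf : ContDiff ℝ ω f) {t₀ : ℝ} {u₀ : E}
    (h0 : f (t₀, u₀) = 0) {f' : E →L[ℝ] E} (h : HasFDerivAt (fun u => f (t₀, u)) f' u₀)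
    (hinj : Function.Injective f') :
    ∃ φ : ℝ → E, ContDiffAt ℝ ω φ t₀ ∧ φ t₀ = u₀ ∧ (∀ᶠ t in 𝓝 t₀, f (t, φ t) = 0) ∧
      ∀ᶠ p in 𝓝 (t₀, u₀), f p = 0 ↔ φ p.1 = p.2 := by
  have : CompleteSpace E := FiniteDimensional.complete ℝ E
  have hω : (ω : WithTop ℕ∞) ≠ 0 := by decide
  have hfa : ContDiffAt ℝ ω f (t₀, u₀) := hf.contDiffAt
  have hd : fderiv ℝ f (t₀, u₀) ∘L .inr ℝ ℝ E = f' := by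
    refine HasFDerivAt.unique ?_ h
    exact (hfa.differentiableAt hω).hasFDerivAt.comp u₀ (hasFDerivAt_prodMk_right t₀ u₀)
  have hi : (fderiv ℝ f (t₀, u₀) ∘L .inr ℝ ℝ E).IsInvertible := by
    rw [hd]
    exact ContinuousLinearMap.isInvertible_of_injective hinj
  refine ⟨hfa.implicitFunction hω hi, hfa.contDiffAt_implicitFunction hω hi,
    hfa.implicitFunction_apply_self hω hi, ?_, ?_⟩
  · simpa only [h0] using hfa.eventually_apply_implicitFunction hω hi
  · simpa only [h0] using hfa.eventually_apply_eq_iff_implicitFunction hω hi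

namespace Dziobek

open PolyExpr

theorem eq_symVec_of_swap12_eq {x : Vars} (hx : swap12 x = x) :
    x = symVec fun i => x (![0, 1, 2, 3, 6, 7] i) := by
  have h4 := congrFun hx 4
  have h5 := congrFun hx 5
  simp only [swap12, Matrix.cons_val] at h4 h5
  funext i
  fin_cases i <;> simp [symVec, h4, h5]

theorem swap12_symVec (p : Fin 6 → ℝ) : swap12 (symVec p) = symVec p := by
  funext i
  fin_cases i <;> simp [swap12, symVec]

/-- Equivariance maps fixed vectors to fixed vectors, so six components determine the value and the
symmetric problem is square. -/
theorem F_symVec (m : ℝ) (p : Fin 6 → ℝ) :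
    F m (symVec p) = symVec fun i => F m (symVec p) (![0, 1, 2, 3, 6, 7] i) := by
  have h := F_swap12 m (symVec p)
  rw [swap12_symVec] at h
  exact eq_symVec_of_swap12_eq h.symm

/-- `symVec` as a continuous linear map. -/
noncomputable def symVecCLM : (Fin 6 → ℝ) →L[ℝ] Vars :=
  LinearMap.toContinuousLinearMap
    { toFun := symVec
      map_add' := fun p q => by funext i; fin_cases i <;> simp [symVec]
      map_smul' := fun c p => by funext i; fin_cases i <;> simp [symVec] }

theorem symVecCLM_apply (p : Fin 6 → ℝ) : symVecCLM p = symVec p := rfl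

/-- The symmetric part of the unknowns. -/
noncomputable def symPart (x : Vars) : Fin 6 → ℝ :=
  ![x 0, x 1, x 2, (x 3 + x 5) / 2, (x 4 + x 6) / 2, x 7]

theorem continuous_symPart : Continuous symPart := by
  refine continuous_pi fun i => ?_
  fin_cases i <;> simp [symPart] <;> fun_prop

theorem symPart_displaced (z : Fin 9 → ℝ) (y : ℝ) :
    symPart (displaced z y) = ![z 0, z 1, z 2, z 3, z 4, z 5] := by
  funext i
  fin_cases i <;> simp [symPart, displaced]

theorem symVec_symPart_displaced (z : Fin 9 → ℝ) :
    symVec (symPart (displaced z 0)) = displaced z 0 := by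
  rw [symPart_displaced]
  funext i
  fin_cases i <;> simp [symVec, displaced]

/-- The branch of symmetric solutions. -/
theorem exists_symmetric_branch {z : Fin 9 → ℝ} (hz : Near (10 ^ 40) z)
    (hF : F (z 7) (displaced z 0) = 0) :
    ∃ ψ : ℝ → Fin 6 → ℝ, ContDiffAt ℝ ω ψ (z 7) ∧ ψ (z 7) = symPart (displaced z 0) ∧
      (∀ᶠ m in 𝓝 (z 7), F m (symVec (ψ m)) = 0) ∧
      ∀ᶠ p : ℝ × (Fin 6 → ℝ) in 𝓝 (z 7, symPart (displaced z 0)),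
        F p.1 (symVec p.2) = 0 → ψ p.1 = p.2 := by
  let f : ℝ × (Fin 6 → ℝ) → Fin 6 → ℝ := fun p i => F p.1 (symVec p.2) (![0, 1, 2, 3, 6, 7] i)
  have hf : ContDiff ℝ ω f := by
    have h : ContDiff ℝ ω fun p : ℝ × (Fin 6 → ℝ) => F p.1 (symVec p.2) :=
      ContDiff.comp (g := fun p : ℝ × Vars => F p.1 p.2)
        (f := fun p : ℝ × (Fin 6 → ℝ) => (p.1, symVecCLM p.2)) contDiff_F
        (contDiff_fst.prodMk (symVecCLM.contDiff.comp contDiff_snd))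
    exact contDiff_pi.2 fun i => contDiff_pi.1 h _
  have hsym := symVec_symPart_displaced z
  have h0 : f (z 7, symPart (displaced z 0)) = 0 := by
    funext i
    simp only [f, hsym, hF, Pi.zero_apply]
  have hd : HasFDerivAt (fun p => f (z 7, p))
      (LinearMap.toContinuousLinearMap (symJac z).mulVecLin) (symPart (displaced z 0)) := by
    have h1 : HasFDerivAt (fun p => F (z 7) (symVec p))
        ((fderiv ℝ (F (z 7)) (displaced z 0)).comp symVecCLM) (symPart (displaced z 0)) := by
      have h2 := hasFDerivAt_F (z 7) (symVecCLM (symPart (displaced z 0)))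
      rw [symVecCLM_apply, hsym] at h2
      exact HasFDerivAt.comp (f := symVecCLM) _ (by rwa [symVecCLM_apply, hsym])
        symVecCLM.hasFDerivAt
    refine hasFDerivAt_pi'.2 fun i => ?_
    refine ((hasFDerivAt_pi'.1 h1) (![0, 1, 2, 3, 6, 7] i)).congr_fderiv ?_
    ext p
    have h2 := congrFun (fderiv_F_symVec z hz.2 p) (![0, 1, 2, 3, 6, 7] i)
    refine h2.trans ?_
    change symVec ((symJac z).mulVec p) _ = (symJac z).mulVec p i
    fin_cases i <;> rfl
  have hf0 : ∀ m p, F m (symVec p) = 0 ↔ f (m, p) = 0 := fun m p => by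
    constructor
    · intro h
      funext i
      simp only [f, h, Pi.zero_apply]
    · intro h
      rw [F_symVec]
      change symVec (f (m, p)) = 0
      rw [h, symVec_zero]
  obtain ⟨ψ, h1, h2, h3, h4⟩ := exists_implicit_branch hf h0 hd (symJac_mulVec_injective hz)
  refine ⟨ψ, h1, h2, h3.mono fun m hm => (hf0 _ _).2 hm, h4.mono fun p hp hFp => ?_⟩
  exact hp.1 ((hf0 _ _).1 hFp)

/-- Zeros near the bifurcation point are symmetric or displaced in a direction close to the kernel
of the Jacobian matrix. -/
theorem eventually_slope_close {z : Fin 9 → ℝ} (hz : Near (10 ^ 10) z)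
    (h3 : (oddExpr 3).eval z = 0) {c : ℝ} (hc : 0 < c) :
    ∀ᶠ p : ℝ × Vars in 𝓝 (z 7, displaced z 0), F p.1 p.2 = 0 →
      |(p.2 3 - p.2 5) / 2 - (p.2 6 - p.2 4) / 2 * z 6| ≤ c * |(p.2 6 - p.2 4) / 2| := by
  have hz' : Near (10 ^ 40) z := hz.mono (by norm_num)
  have h12 := twelve_le_slope hz'
  -- `g` vanishes at zeros of `F` and at all symmetric configurations, while its derivative on the
  -- antisymmetric vector `(a, b)` is a nonzero multiple of `a - b * z 6`.
  let g : ℝ × Vars → ℝ := fun p => F p.1 p.2 3 - F p.1 p.2 5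
  have hg : ContDiff ℝ 1 g := (contDiff_pi.1 contDiff_F 3).sub (contDiff_pi.1 contDiff_F 5)
  have hstrict := hg.contDiffAt.hasStrictFDerivAt (x := (z 7, displaced z 0)) one_ne_zero
  have hg' : ∀ a b, fderiv ℝ g (z 7, displaced z 0) (0, antiVec a b)
      = 2 * ((a - b * z 6) * ((oddExpr 3).pderiv 6).eval z) := fun a b => by
    have h1 := hstrict.hasFDerivAt.comp (displaced z 0)
      (hasFDerivAt_prodMk_right (𝕜 := ℝ) (z 7) (displaced z 0))
    have h2 := hasFDerivAt_F (z 7) (displaced z 0)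
    have h4 := ((hasFDerivAt_pi'.1 h2) 3).sub ((hasFDerivAt_pi'.1 h2) 5)
    have h5 := congrArg (fun L => L (antiVec a b)) (h1.unique h4)
    refine h5.trans ?_
    change fderiv ℝ (F (z 7)) (displaced z 0) (antiVec a b) 3
      - fderiv ℝ (F (z 7)) (displaced z 0) (antiVec a b) 5 = _
    rw [fderiv_F_antiVec z hz.2, h3]
    simp [antiVec]
    ring
  -- Strict differentiability compares a zero with its own symmetrization. Both values of `g`
  -- vanish, so the linear term is small relative to `|a| + |b|`.
  have hsmall := hstrict.isLittleO.def (lt_min hc one_pos)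
  have htend : Filter.Tendsto (fun p : ℝ × Vars => (p, (p.1, symVec (symPart p.2))))
      (𝓝 (z 7, displaced z 0)) (𝓝 ((z 7, displaced z 0), (z 7, displaced z 0))) := by
    have hcont : Continuous fun p : ℝ × Vars => (p, (p.1, symVecCLM (symPart p.2))) :=
      continuous_id.prodMk (continuous_fst.prodMk
        (symVecCLM.continuous.comp (continuous_symPart.comp continuous_snd)))
    have h := hcont.tendsto (z 7, displaced z 0)
    simp only [symVecCLM_apply, symVec_symPart_displaced] at h
    exact h
  have hslope : |z 6| ≤ 1 := by
    have h := abs_slope_sub_le hz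
    rw [abs_le] at h ⊢
    constructor <;> linarith [h.1, h.2]
  filter_upwards [htend.eventually hsmall] with p hp hF
  set a := (p.2 3 - p.2 5) / 2 with ha
  set b := (p.2 6 - p.2 4) / 2 with hb
  have hsub : p - (p.1, symVec (symPart p.2)) = (0, antiVec a b) := by
    refine Prod.ext (sub_self _) ?_
    change p.2 - symVec (symPart p.2) = antiVec a b
    rw [sub_eq_iff_eq_add']
    exact eq_symVec_add_antiVec p.2
  have hg1 : g p = 0 := by simp [g, hF]
  have hg2 : g (p.1, symVec (symPart p.2)) = 0 := by
    simp only [g]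
    rw [F_symVec]
    simp [symVec]
  have hnorm : ‖((0 : ℝ), antiVec a b)‖ ≤ |a| + |b| := by
    rw [Prod.norm_mk, norm_zero, max_eq_right (norm_nonneg _)]
    refine (pi_norm_le_iff_of_nonneg (by positivity)).2 fun i => ?_
    have := abs_nonneg a
    have := abs_nonneg b
    fin_cases i <;> simp [antiVec] <;> linarith
  simp only [hsub] at hp
  rw [hg1, hg2, hg', sub_self, zero_sub, norm_neg, Real.norm_eq_abs, abs_mul, abs_mul,
    abs_of_pos (by norm_num : (0 : ℝ) < 2), abs_of_pos (by linarith : 0 < eval z _)] at hp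
  have hp' := hp.trans (mul_le_mul_of_nonneg_left hnorm (lt_min hc one_pos).le)
  generalize ((oddExpr 3).pderiv 6).eval z = β at *
  have hk1 : min c 1 ≤ 1 := min_le_right _ _
  have hkc : min c 1 ≤ c := min_le_left _ _
  have hk0 : 0 < min c 1 := lt_min hc one_pos
  generalize min c 1 = k at *
  have ha1 : |a| ≤ |a - b * z 6| + |b| := by
    have h1 : |a| ≤ |a - b * z 6| + |b * z 6| := by
      simpa using abs_add_le (a - b * z 6) (b * z 6)
    have h2 : |b * z 6| ≤ |b| := by
      rw [abs_mul]
      exact mul_le_of_le_one_right (abs_nonneg _) hslope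
    linarith
  have hd0 := abs_nonneg (a - b * z 6)
  have hb0 := abs_nonneg b
  generalize |a - b * z 6| = d at *
  -- Together these give `24 d ≤ k (d + 2 |b|) ≤ d + 2 c |b|`, hence `23 d ≤ 2 c |b|`.
  have e1 : 24 * d ≤ 2 * (d * β) := by nlinarith
  have e2 : k * (|a| + |b|) ≤ k * (d + 2 * |b|) := mul_le_mul_of_nonneg_left (by linarith) hk0.le
  have e3 : k * d ≤ d := mul_le_of_le_one_left hd0 hk1
  have e4 : k * |b| ≤ c * |b| := mul_le_mul_of_nonneg_right hkc hb0
  have e5 : 0 ≤ k * |b| := by positivity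
  linarith

/-- Up to sign and the scale `10 ^ 11`, this approximates the velocity `-J⁻¹ ∂G/∂(y²)` of the
asymmetric branch, with the tolerance of `paramTable` included; row 7 is the mass. -/
theorem jacInvTable_mul_paramTable :
    (∀ i : Fin 8, |∑ k, jacInvTable i k * paramTable k| + 2 * ∑ k, |jacInvTable i k|
      ≤ 130 * 10 ^ 11) ∧
    ∑ k, jacInvTable 7 k * paramTable k + 2 * ∑ k, |jacInvTable 7 k| ≤ -20 * 10 ^ 11 := by
  decide +kernel

/-- The mass increases with `y²` along the branch of asymmetric solutions. -/
theorem mass_deriv_pos {z : Fin 9 → ℝ} (hz : Near (10 ^ 10) z) {v : Vars}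
    (hv : ∀ i, (blowUpJac z).mulVec v i + ((blowUpExpr i).pderiv 8).eval z = 0) : 0 < v 7 := by
  have hz' : Near (10 ^ 40) z := hz.mono (by norm_num)
  -- The direction of the bifurcation is decided by the full system `J v = -S`, which includes the
  -- bending of the symmetric unknowns; the sign of `D³F` is not used.
  let S : Vars := fun i => ((blowUpExpr i).pderiv 8).eval z
  have hS : ∀ k, |S k * 10 ^ 6 - paramTable k| ≤ 2 := fun k => by
    have h := hz.abs_eval_mul_sub_le (by norm_num) (paramTable_within k)
    norm_num at h ⊢
    exact h
  have hJ : (blowUpJac z).mulVec v = -S := funext fun i => eq_neg_of_add_eq_zero_left (hv i)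
  have happ := norm_sub_jacInv_mulVec_le hz' v
  have htwo := norm_le_two_mul_of_approxInverse (norm_sub_jacInv_mulVec_le hz') v
  rw [hJ, Matrix.mulVec_neg, sub_neg_eq_add] at happ
  rw [hJ, Matrix.mulVec_neg, norm_neg] at htwo
  have herr : ∀ i, |jacInv.mulVec S i * 10 ^ 11 - ((∑ k, jacInvTable i k * paramTable k : ℤ) : ℝ)|
      ≤ ((2 * ∑ k, |jacInvTable i k| : ℤ) : ℝ) := fun i => by
    have e : jacInv.mulVec S i * 10 ^ 11 - ((∑ k, jacInvTable i k * paramTable k : ℤ) : ℝ)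
        = ∑ k, (jacInvTable i k : ℝ) * (S k * 10 ^ 6 - paramTable k) := by
      have h1 : jacInv.mulVec S i = ∑ k, (jacInvTable i k : ℝ) / (10 ^ 5 : ℤ) * S k := rfl
      rw [h1, Finset.sum_mul]
      push_cast
      rw [← Finset.sum_sub_distrib]
      refine Finset.sum_congr rfl fun k _ => ?_
      ring
    rw [e]
    push_cast
    rw [Finset.mul_sum]
    refine (Finset.abs_sum_le_sum_abs _ _).trans (Finset.sum_le_sum fun k _ => ?_)
    rw [abs_mul, mul_comm]
    exact mul_le_mul_of_nonneg_right (hS k) (abs_nonneg _)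
  obtain ⟨hall, h7⟩ := jacInvTable_mul_paramTable
  have hκ : ‖jacInv.mulVec S‖ ≤ 130 := by
    refine (pi_norm_le_iff_of_nonneg (by norm_num)).2 fun i => ?_
    have h1 : ((|∑ k, jacInvTable i k * paramTable k| + 2 * ∑ k, |jacInvTable i k| : ℤ) : ℝ)
        ≤ ((130 * 10 ^ 11 : ℤ) : ℝ) := Int.cast_le.2 (hall i)
    have h2 := herr i
    rw [Int.cast_add, Int.cast_abs] at h1
    generalize ((∑ k, jacInvTable i k * paramTable k : ℤ) : ℝ) = A at *
    generalize ((2 * ∑ k, |jacInvTable i k| : ℤ) : ℝ) = B at *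
    rw [Real.norm_eq_abs]
    have h3 := abs_add_le (jacInv.mulVec S i * 10 ^ 11 - A) A
    rw [sub_add_cancel, abs_mul, abs_of_pos (by norm_num : (0 : ℝ) < 10 ^ 11)] at h3
    push_cast at h1
    linarith
  have hκ7 : jacInv.mulVec S 7 ≤ -20 := by
    have h1 : ((∑ k, jacInvTable 7 k * paramTable k + 2 * ∑ k, |jacInvTable 7 k| : ℤ) : ℝ)
        ≤ ((-20 * 10 ^ 11 : ℤ) : ℝ) := Int.cast_le.2 h7
    have h2 := (abs_le.1 (herr 7)).2
    rw [Int.cast_add] at h1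
    generalize ((∑ k, jacInvTable 7 k * paramTable k : ℤ) : ℝ) = A at *
    generalize ((2 * ∑ k, |jacInvTable 7 k| : ℤ) : ℝ) = B at *
    push_cast at h1
    linarith
  -- The approximate inverse costs at most `‖v‖ / 100 ≤ 2 * 130 / 100`, well below the available
  -- `20`.
  have hcomp : |v 7 + jacInv.mulVec S 7| ≤ 1 / 100 * ‖v‖ :=
    (norm_le_pi_norm (v + jacInv.mulVec S) 7).trans happ
  have := (abs_le.1 hcomp).1
  linarith

end Dziobek

/-! ### Blown-up coordinates and assembly of the pitchfork -/

namespace Dziobek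

open PolyExpr

/-- The coordinates of a configuration with prescribed slope: its symmetric part, the slope and the
mass. -/
noncomputable def blowUpCoords (p : ℝ × Vars) (a : ℝ) : Vars :=
  ![p.2 0, p.2 1, p.2 2, (p.2 3 + p.2 5) / 2, (p.2 4 + p.2 6) / 2, p.2 7, a, p.1]

theorem continuous_blowUpCoords (a : ℝ) : Continuous fun p => blowUpCoords p a := by
  refine continuous_pi fun i => ?_
  fin_cases i <;> simp [blowUpCoords] <;> fun_prop

theorem dist_blowUpCoords_le (p : ℝ × Vars) (a a' : ℝ) :
    dist (blowUpCoords p a) (blowUpCoords p a') ≤ |a - a'| := by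
  refine (dist_pi_le_iff (abs_nonneg _)).2 fun i => ?_
  fin_cases i <;> simp [blowUpCoords, Real.dist_eq]

theorem extend_blowUpCoords_mass (p : ℝ × Vars) (a s : ℝ) :
    extend (blowUpCoords p a) s 7 = p.1 := rfl

/-- Off the symmetric set the slope is recovered by dividing by the displacement, so the blow-up can
be inverted. -/
theorem displaced_blowUpCoords (p : ℝ × Vars) (s : ℝ) (hy : (p.2 6 - p.2 4) / 2 ≠ 0) :
    displaced (extend (blowUpCoords p ((p.2 3 - p.2 5) / 2 / ((p.2 6 - p.2 4) / 2))) s)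
      ((p.2 6 - p.2 4) / 2) = p.2 := by
  have h : (p.2 6 - p.2 4) / 2 * ((p.2 3 - p.2 5) / 2 / ((p.2 6 - p.2 4) / 2))
      = (p.2 3 - p.2 5) / 2 := mul_div_cancel₀ _ hy
  funext i
  fin_cases i <;> simp only [displaced, extend, blowUpCoords, Matrix.cons_val, Fin.zero_eta,
    Fin.mk_one, Fin.reduceFinMk, h] <;> ring

theorem blowUpCoords_displaced (u : Vars) :
    blowUpCoords (u 7, displaced (extend u 0) 0) (u 6) = u := by
  funext i
  fin_cases i <;> simp [blowUpCoords, displaced, extend]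

/-- The `y`-coordinate of a configuration. -/
noncomputable def displacement : Vars →L[ℝ] ℝ :=
  (1 / 2 : ℝ) • (ContinuousLinearMap.proj (R := ℝ) (φ := fun _ : Fin 8 => ℝ) 6
    - ContinuousLinearMap.proj (R := ℝ) (φ := fun _ : Fin 8 => ℝ) 4)

theorem displacement_apply (x : Vars) : displacement x = (x 6 - x 4) / 2 := by
  simp [displacement]
  ring

theorem displacement_displaced (z : Fin 9 → ℝ) (y : ℝ) : displacement (displaced z y) = y := by
  simp [displacement_apply, displaced]

theorem displacement_symVec (p : Fin 6 → ℝ) : displacement (symVec p) = 0 := by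
  simp [displacement_apply, symVec]

theorem contDiff_displaced_extend {n : WithTop ℕ∞} :
    ContDiff ℝ n fun q : (ℝ × Vars) × ℝ => displaced (extend q.1.2 q.1.1) q.2 := by
  refine contDiff_pi.2 fun i => ?_
  fin_cases i <;> simp [displaced, extend] <;> fun_prop

/-- The branch of asymmetric solutions. -/
theorem exists_asymmetric_branch {u : Vars} (hz : Near (10 ^ 10) (extend u 0))
    (hG : blowUp (0, u) = 0) :
    ∃ φ : ℝ → Vars, ContDiffAt ℝ ω φ 0 ∧ φ 0 = u ∧ 0 < deriv (fun t => φ t 7) 0 ∧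
      (∀ᶠ t in 𝓝 (0 : ℝ), blowUp (t, φ t) = 0) ∧
      ∀ᶠ p in 𝓝 ((0 : ℝ), u), blowUp p = 0 → φ p.1 = p.2 := by
  have hz' : Near (10 ^ 40) (extend u 0) := hz.mono (by norm_num)
  obtain ⟨φ, h1, h2, h3, h4⟩ := exists_implicit_branch contDiff_blowUp hG (hasFDerivAt_blowUp 0 u)
    (mulVec_injective_of_approxInverse (norm_sub_jacInv_mulVec_le hz'))
  refine ⟨φ, h1, h2, ?_, h3, h4.mono fun p hp => hp.1⟩
  have hφ : HasDerivAt φ (deriv φ 0) 0 := (h1.differentiableAt (by decide)).hasDerivAt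
  rw [((hasDerivAt_pi.1 hφ) 7).deriv]
  refine mass_deriv_pos hz fun i => ?_
  -- The identity `G(t, φ t) = 0` is differentiated at `t = 0`; the last coordinate contributes
  -- `∂G/∂t`.
  have hc : HasDerivAt (fun t => extend (φ t) t) (extend (deriv φ 0) 1) 0 :=
    extendCLM.hasFDerivAt.comp_hasDerivAt (0 : ℝ) ((hasDerivAt_id (0 : ℝ)).prodMk hφ)
  have hd := (blowUpExpr i).hasDerivAt_eval_comp hc
  have h0 : HasDerivAt (fun t => (blowUpExpr i).eval (extend (φ t) t)) 0 0 :=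
    (hasDerivAt_const (0 : ℝ) (0 : ℝ)).congr_of_eventuallyEq
      (h3.mono fun t ht => (blowUp_apply (t, φ t) i).symm.trans (congrFun ht i))
  have h5 := hd.unique h0
  rw [h2, Fin.sum_univ_castSucc] at h5
  simp only [extend_castSucc] at h5
  rw [show extend (deriv φ 0) 1 (Fin.last 8) = 1 from rfl, mul_one] at h5
  exact h5

/-- The pitchfork bifurcation at a zero of the blown-up equations. -/
theorem isSupercriticalPitchfork_F {u : Vars} (hz : Near (10 ^ 10) (extend u 0))
    (hG : blowUp (0, u) = 0) :
    IsSupercriticalPitchfork F (u 7) (displaced (extend u 0) 0) := by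
  have hz' : Near (10 ^ 40) (extend u 0) := hz.mono (by norm_num)
  have hmass : ∀ (v : Vars) (s : ℝ), extend v s 7 = v 7 := fun _ _ => rfl
  have hF0 : F (extend u 0 7) (displaced (extend u 0) 0) = 0 :=
    F_displaced_eq_zero (by simp [extend_last]) fun i => by
      rw [← blowUp_apply (0, u), hG, Pi.zero_apply]
  have hodd : (oddExpr 3).eval (extend u 0) = 0 := congrFun hG 6
  obtain ⟨ψ, hψ, hψ0, hψF, hψu⟩ := exists_symmetric_branch hz' hF0
  obtain ⟨φ, hφ, hφ0, hφ', hφG, hφu⟩ := exists_asymmetric_branch hz hG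
  rw [hmass] at hψ hψ0 hψF hψu
  have hsq : Filter.Tendsto (fun y : ℝ => y ^ 2) (𝓝 0) (𝓝 0) := by
    simpa using (continuous_pow 2).tendsto (0 : ℝ)
  have hdisp : Filter.Tendsto (fun p : ℝ × Vars => displacement p.2)
      (𝓝 (u 7, displaced (extend u 0) 0)) (𝓝 0) := by
    have h := (displacement.continuous.comp continuous_snd).tendsto
      (u 7, displaced (extend u 0) 0)
    simp only [Function.comp_apply, displacement_displaced] at h
    exact h
  refine isSupercriticalPitchfork_of_branches displacement (s := fun m => symVec (ψ m))
    (X := fun y => displaced (extend (φ (y ^ 2)) (y ^ 2)) y) (τ := fun t => φ t 7)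
    (symVecCLM.contDiff.contDiffAt.comp _ hψ) ?_ ?_ ?_ ?_ ?_ hφ'
    (Filter.Eventually.of_forall fun m => displacement_symVec _)
    (Filter.Eventually.of_forall fun y => displacement_displaced _ _) ?_
  · rw [hψ0, symVec_symPart_displaced]
  · have h1 : ContDiffAt ℝ ω (fun y : ℝ => φ (y ^ 2)) 0 :=
      ContDiffAt.comp (f := fun y : ℝ => y ^ 2) 0 (by simpa using hφ) (by fun_prop)
    exact ContDiffAt.comp (g := fun q : (ℝ × Vars) × ℝ => displaced (extend q.1.2 q.1.1) q.2)
      (f := fun y : ℝ => ((y ^ 2, φ (y ^ 2)), y)) 0 contDiff_displaced_extend.contDiffAt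
      (((contDiffAt_id.pow 2).prodMk h1).prodMk contDiffAt_id)
  · simp [hφ0]
  · exact contDiffAt_pi.1 hφ 7
  · rw [hφ0]
  -- `φ` accounts only for zeros of `G` within `r` of `(0, u)`. Zeros of `F` are brought there by
  -- the slope bound `r / 4` and the bound `r / 2` on the other coordinates.
  · obtain ⟨r, hr, hφr⟩ := Metric.eventually_nhds_iff.1 hφu
    have hsym : ∀ᶠ p : ℝ × Vars in 𝓝 (u 7, displaced (extend u 0) 0),
        F p.1 (symVec (symPart p.2)) = 0 → ψ p.1 = symPart p.2 :=
      ((continuous_fst.prodMk (continuous_symPart.comp continuous_snd)).tendsto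
        (u 7, displaced (extend u 0) 0)).eventually hψu
    have hslope := eventually_slope_close hz hodd (c := r / 4) (by positivity)
    rw [hmass] at hslope
    have hclose : ∀ᶠ p : ℝ × Vars in 𝓝 (u 7, displaced (extend u 0) 0),
        dist (displacement p.2 ^ 2, blowUpCoords p (u 6)) ((0 : ℝ), u) < r / 2 := by
      have hcont : Continuous fun p : ℝ × Vars =>
          (displacement p.2 ^ 2, blowUpCoords p (u 6)) :=
        ((displacement.continuous.comp continuous_snd).pow 2).prodMk (continuous_blowUpCoords _)
      have h := hcont.tendsto (u 7, displaced (extend u 0) 0)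
      rw [displacement_displaced, blowUpCoords_displaced, zero_pow two_ne_zero] at h
      exact h.eventually (Metric.ball_mem_nhds _ (half_pos hr))
    have hψF' : ∀ᶠ p : ℝ × Vars in 𝓝 (u 7, displaced (extend u 0) 0),
        F p.1 (symVec (ψ p.1)) = 0 :=
      (continuous_fst.tendsto (u 7, displaced (extend u 0) 0)).eventually hψF
    have hφG' := (hsq.comp hdisp).eventually hφG
    filter_upwards [hsym, hslope, hclose, hψF', hφG'] with p hp1 hp2 hp3 hp4 hp5
    simp only [Function.comp_apply] at hp5
    constructor
    · intro hF
      have hslope := hp2 hF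
      rw [← displacement_apply] at hslope
      by_cases hy : displacement p.2 = 0
      · left
        rw [hy, abs_zero, mul_zero, zero_mul, sub_zero] at hslope
        have hx : p.2 = symVec (symPart p.2) := by
          have h := eq_symVec_add_antiVec p.2
          rw [← displacement_apply, hy, abs_nonpos_iff.1 hslope] at h
          have h0 : antiVec 0 0 = 0 := by
            funext i
            fin_cases i <;> simp [antiVec]
          rwa [h0, add_zero] at h
        rw [hp1 (by rwa [← hx])]
        exact hx
      · right
        have hd := displaced_blowUpCoords p (displacement p.2 ^ 2)
          (by rwa [← displacement_apply])
        rw [← displacement_apply] at hd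
        generalize ha : (p.2 3 - p.2 5) / 2 / displacement p.2 = a at *
        have hau : |a - u 6| ≤ r / 4 := by
          have e : a - u 6 = ((p.2 3 - p.2 5) / 2 - displacement p.2 * extend u 0 6)
              / displacement p.2 := by
            rw [sub_div, ha, mul_div_cancel_left₀ _ hy]
            rfl
          rw [e, abs_div, div_le_iff₀ (abs_pos.2 hy)]
          exact hslope
        have hdist : dist (displacement p.2 ^ 2, blowUpCoords p a) ((0 : ℝ), u) < r := by
          have h1 : dist (displacement p.2 ^ 2, blowUpCoords p a)
              (displacement p.2 ^ 2, blowUpCoords p (u 6)) ≤ r / 4 := by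
            rw [Prod.dist_eq, dist_self, max_eq_right dist_nonneg]
            exact (dist_blowUpCoords_le p a (u 6)).trans hau
          have h2 := dist_triangle (displacement p.2 ^ 2, blowUpCoords p a)
            (displacement p.2 ^ 2, blowUpCoords p (u 6)) ((0 : ℝ), u)
          linarith
        have hzero : blowUp (displacement p.2 ^ 2, blowUpCoords p a) = 0 := by
          funext i
          rw [blowUp_apply]
          refine blowUp_eq_zero (y := displacement p.2) (extend_last _ _) hy ?_ i
          rw [hd, extend_blowUpCoords_mass]
          exact hF
        have hφp : φ (displacement p.2 ^ 2) = blowUpCoords p a := hφr hdist hzero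
        rw [hφp, hd]
        exact ⟨rfl, rfl⟩
    · rintro (h | ⟨h1, h2⟩)
      · rw [h]
        exact hp4
      · rw [h1, h2]
        have h := F_displaced_eq_zero
          (z := extend (φ (displacement p.2 ^ 2)) (displacement p.2 ^ 2))
          (y := displacement p.2) (extend_last _ _) fun i => by
            rw [← blowUp_apply (displacement p.2 ^ 2, φ (displacement p.2 ^ 2)), hp5,
              Pi.zero_apply]
        rwa [hmass] at h

end Dziobek

/-! ### The main theorem -/

open Dziobek Matrix in
theorem mainTheorem5 :
    ∃ (m : ℝ) (x : Vars),
      -- the bifurcation point: existence and uniqueness in the box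
      InBox m x ∧ IsSymmetricSingularSolution m x ∧
      (∀ (m' : ℝ) (x' : Vars), InBox m' x' → IsSymmetricSingularSolution m' x' →
        m' = m ∧ x' = x) ∧
      -- zero is a simple eigenvalue of the Jacobian matrix
      (jacobian m x).charpoly.rootMultiplicity 0 = 1 ∧
      ∃ v w : Fin 8 → ℝ,
        -- `v` spans the kernel, is antisymmetric, and is normalized
        LinearMap.ker (jacobian m x).mulVecLin = Submodule.span ℝ {v} ∧
        swap12 v = -v ∧ v 6 = 1 ∧ |v 3 - 0.3503863414744728128369| ≤ 1 / 10 ^ 22 ∧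
        -- `w` spans the kernel of the transpose, and is normalized
        LinearMap.ker (jacobian m x)ᵀ.mulVecLin = Submodule.span ℝ {w} ∧
        swap12 w = -w ∧ w 6 = 1 ∧ |w 3 - 1.0453646029495395551308| ≤ 1 / 10 ^ 22 ∧
        -- the conditions on the derivatives
        w ⬝ᵥ paramDeriv m x = 0 ∧
        w ⬝ᵥ fderiv ℝ (paramDeriv m) x v ≠ 0 ∧
        |w ⬝ᵥ fderiv ℝ (paramDeriv m) x v - 27.1877227151147526097| ≤ 1 / 10 ^ 19 ∧
        w ⬝ᵥ iteratedFDeriv ℝ 2 (F m) x ![v, v] = 0 ∧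
        w ⬝ᵥ iteratedFDeriv ℝ 3 (F m) x ![v, v, v] < 0 ∧
        |w ⬝ᵥ iteratedFDeriv ℝ 3 (F m) x ![v, v, v] - (-2639.9736664601674948)| ≤ 1 / 10 ^ 16 ∧
        -- the bifurcation
        IsSupercriticalPitchfork F m x := by
  obtain ⟨hunique, u, hu, hG⟩ := blowUp_exists_unique_zero
  have hfork := isSupercriticalPitchfork_F hu hG
  have hG' : ∀ i, (blowUpExpr i).eval (extend u 0) = 0 := fun i => by
    rw [← blowUp_apply (0, u), hG, Pi.zero_apply]
  have hu' : Near (10 ^ 40) (extend u 0) := hu.mono (by norm_num)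
  have hmass : extend u 0 7 = u 7 := rfl
  rw [← hmass] at hfork
  have huniq : ∀ (m' : ℝ) (x' : Vars), InBox m' x' → IsSymmetricSingularSolution m' x' →
      m' = extend u 0 7 ∧ x' = displaced (extend u 0) 0 := by
    intro m' x' hbox hx'
    -- The slope of a kernel vector completes any competing solution to a zero of the blown-up
    -- equations, where uniqueness is known.
    obtain ⟨a, ha, hGa⟩ := exists_blowUp_zero_of_singular hbox hx'
    have h := hunique _ _ ha hu' hGa hG
    rw [← h, displaced_symCoords hx'.r13_eq_r23 hx'.r14_eq_r24, extend_symCoords_mass]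
    exact ⟨rfl, rfl⟩
  have h3 : (oddExpr 3).eval (extend u 0) = 0 := hG' 6
  have h6 : (oddExpr 6).eval (extend u 0) = 0 := hG' 7
  have hz8 : extend u 0 8 = 0 := hu.2
  generalize extend u 0 = z at *
  have hv := ker_jacobian_eq_span hu' h3 h6
  have hw := antiVec_leftSlope_dotProduct hu' h3 h6
  have hslope := abs_slope_sub_le hu
  have hleft := abs_leftSlope_sub_le hu
  have hmixed := abs_mixed_sub_le hu
  have hcubic := abs_cubic_sub_le hu
  rw [← antiVec_dotProduct_fderiv_paramDeriv z hz8] at hmixed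
  obtain ⟨hD2, hD3⟩ := antiVec_dotProduct_second_third z hz8 (leftSlope z)
  rw [← hD3] at hcubic
  -- The product equals `2 (leftSlope z * z 6 + 1)`, and both slopes are positive.
  have hwv : antiVec (leftSlope z) 1 ⬝ᵥ antiVec (z 6) 1 ≠ 0 := by
    rw [antiVec_dotProduct]
    have h1 := (abs_le.1 hslope).1
    have h2 := (abs_le.1 hleft).1
    have h3 : 0 < z 6 := by linarith
    have h4 : 0 < leftSlope z := by linarith
    simp only [antiVec, Matrix.cons_val]
    nlinarith [mul_pos h3 h4]
  refine ⟨z 7, displaced z 0, inBox_of_near hu, isSymmetricSingularSolution hu' hG', huniq,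
    Matrix.rootMultiplicity_charpoly_zero_eq_one hv hw hwv, antiVec (z 6) 1,
    antiVec (leftSlope z) 1, hv, swap12_antiVec _ _, rfl, hslope, ?_, swap12_antiVec _ _, rfl,
    hleft, ?_, ?_, hmixed, hD2, ?_, hcubic, hfork⟩
  · refine Matrix.ker_transpose_eq_span (antiVec_one_ne_zero _) (antiVec_one_ne_zero _) hv ?_
    rw [Matrix.mulVec_transpose]
    refine dotProduct_eq_zero_iff.1 fun y => ?_
    rw [← Matrix.dotProduct_mulVec]
    exact hw y
  · rw [antiVec_dotProduct_paramDeriv]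
    simp
  · intro h0
    rw [h0] at hmixed
    norm_num at hmixed
  · have := (abs_le.1 hcubic).2
    linarith
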